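/- Let $Y=(0,1)^3$, $\langle f\rangle=\int_Y f\,dx$, let $\mathbb S^3$ be the symmetric real $3\times3$ matrices, $[\nabla^s v]_{mn}=\frac12(\partial_m v_n+\partial_n v_m)$, and let $F:G=\sum_{m,n}F_{mn}G_{mn}$, $(\mathsf A:F)_{mn}=\sum_{p,q}\mathsf A_{mnpq}F_{pq}$. Let $H^1_\#(Y)$ be the closure of the smooth $Y$-periodic functions in the $H^1(Y)$-norm; $L^2(Y)$-norms of matrix fields use the Frobenius norm. **Data.** Let $M\ge 0$ and $N\ge 1$ be integers, $E\in\mathbb S^3$ and $0<\Lambda',\Lambda''$. (A) $Y$ is, up to a Lebesgue-null set, the union of pairwise disjoint open sets $D_0,\dots,D_M\subset Y$ (for instance Lipschitz subdomains), and $\mathsf C(x)=\mathsf\Lambda_l$ is constant on each $D_l$. (B) $[\mathsf\Lambda_l]_{mnpq}=[\mathsf\Lambda_l]_{nmpq}=[\mathsf\Lambda_l]_{mnqp}=[\mathsf\Lambda_l]_{pqmn}$ and $\Lambda' F:F\le F:\mathsf\Lambda_l:F\le\Lambda''F:F$ for all $F\in\mathbb S^3$ and all $l$. (C) For $I\in\mathcal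 I_N=\{0,\dots,N-1\}^3$ let $Y_I=\prod_{m=1}^3(I_m/N,(I_m+1)/N)$. The field $\mathsf C_N$ equals a constant tensor $\mathsf C_N^\star[I]$ on each $Y_I$, where $\mathsf C_N^\star[I]=\mathsf\Lambda_l$ if $Y_I\subset D_l$, and otherwise $\mathsf C_N^\star[I]$ is an arbitrary element of $\{\mathsf\Lambda_{l}:Y_I\cap D_{l}\ne\varnothing\}$. **Operators.** Let $\mathcal F_N=\{\xi\in\mathbb Z^3:-N/2\le\xi_m<N/2\}$, and let $S_N$ be the space of complex trigonometric polynomials $\sum_{\xi\in\mathcal F_N}c[\xi]e^{2\pi i\xi\cdot x}$. For $f\in L^2(Y;\mathbb C)$ let $\hat f[\xi]=\int_Y f(x)e^{-2\pi i\xi\cdot x}dx$ and $\mathcal P_Nf=\sum_{\xi\in\mathcal F_N}\hat f[\xi]e^{2\pi i\xi\cdot x}$. Let $G_N=N^3\mathbb 1_{[-1/(2N),1/(2N)]^3}$, with Fourier coefficients $\widehat{G_N}[\xi]=\prod_{m=1}^3\frac{N\sin(\pi\xi_m/N)}{\pi\xi_m}$ (a factor with $\xi_m=0$ is read as $1$).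 Put $\mathcal R_Nf=G_N*G_N*f$ (convolutions of periodic extensions) and $$\mathcal Q_Nf(x)=\sum_{\xi\in\mathcal F_N}\widehat{G_N}[\xi]^{-1}e^{-\pi i(\xi_1+\xi_2+\xi_3)/N}\,\widehat{f^\star}[\xi]\,e^{2\pi i\xi\cdot x},$$ where $\widehat{f^\star}[\xi]=N^{-3}\sum_{I\in\mathcal I_N}f^\star[I]e^{-2\pi i\xi\cdot I/N}$ and $f^\star[I]$ is the average of $f$ over $Y_I$. All operators act on matrix fields entrywise. **Theorem.** There is an absolute constant $C>0$ such that the following holds for all data as above. There is exactly one $u_N\in S_N^3$ with $\langle u_N\rangle=0$ such that $$\langle\mathcal R_N(\nabla^s\bar v):\mathcal Q_N(\mathsf C_N:\nabla^su_N)\rangle=-\langle\mathcal R_N(\nabla^s\bar v):\mathcal Q_N(\mathsf C_N:E)\rangle\qquad\text{for all }v\in H^1_\#(Y;\mathbb C^3).$$ Moreover, let $u\in H^1_\#(Y;\mathbb R^3)$ with $\langle u\rangle=0$ solve the periodic cell problem $$\langle\nabla^sv:\mathsf C:\nabla^su\rangle=-\langle\nabla^sv:\mathsf C\rangle:E\qquad\text{for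 all }v\in H^1_\#(Y;\mathbb R^3),$$ and put $\varepsilon=\nabla^su+E$ and $\sigma=\mathsf C:\varepsilon$. Then $$\Lambda'\|\nabla^s(u_N-u)\|_{L^2(Y)}\le C\left\{\Lambda''\|\varepsilon-\mathcal P_N\varepsilon\|_{L^2(Y)}+\|\sigma-\mathcal P_N\sigma\|_{L^2(Y)}+\|(\mathsf C-\mathsf C_N):\varepsilon\|_{L^2(Y)}\right\}.$$ -/

import Mathlib

open MeasureTheory Filter Topology
open scoped ContDiff

noncomputable section

namespace FFTHom

/-! Points of three-dimensional space, second-order and fourth-order tensors. -/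

abbrev Pt : Type := Fin 3 → ℝ

abbrev Mat (𝕜 : Type) : Type := Matrix (Fin 3) (Fin 3) 𝕜

/-- Real fourth-order tensors; `A m n p q` is the component with indices `m, n, p, q`. -/
abbrev Tensor4 : Type := Fin 3 → Fin 3 → Fin 3 → Fin 3 → ℝ

/-- The double contraction `A : F` of a fourth-order tensor with a (real or complex) matrix. -/
def contract {𝕜 : Type} [RCLike 𝕜] (A : Tensor4) (F : Mat 𝕜) : Mat 𝕜 :=
  fun m n => ∑ p, ∑ q, (A m n p q : 𝕜) * F p q

/-- The double contraction `F : G` of two matrices (bilinear, without complex conjugation). -/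
def ddot {𝕜 : Type} [RCLike 𝕜] (F G : Mat 𝕜) : 𝕜 := ∑ m, ∑ n, F m n * G m n

/-- The symmetric part of a matrix. Applied to `G m n = ∂ₘ vₙ` it is the strain `∇ˢ v`. -/
def symPart {𝕜 : Type} [RCLike 𝕜] (G : Mat 𝕜) : Mat 𝕜 := fun m n => (G m n + G n m) / 2

/-- A real matrix viewed as a complex one. -/
def toC (F : Mat ℝ) : Mat ℂ := fun m n => (F m n : ℂ)

/-- Entrywise complex conjugation. -/
def conjMat (F : Mat ℂ) : Mat ℂ := fun m n => (starRingEnd ℂ) (F m n)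

/-- A (scalar) operator on functions, applied to each entry of a matrix field. -/
def entrywise (T : (Pt → ℂ) → Pt → ℂ) (F : Pt → Mat ℂ) : Pt → Mat ℂ :=
  fun x m n => T (fun y => F y m n) x

/-! The unit cell and periodic Sobolev functions. -/

/-- The unit cell `Y = (0,1)³`. -/
def cellY : Set Pt := Set.univ.pi fun _ => Set.Ioo (0 : ℝ) 1

/-- The `L²(Y)`-norm of a matrix field, with the Frobenius norm on matrices. -/
def l2Norm (F : Pt → Mat ℂ) : ℝ := √(∫ x in cellY, ∑ m, ∑ n, ‖F x m n‖ ^ 2)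

/-- The classical partial derivative `∂ₘ f`. -/
def partialDeriv {𝕜 : Type} [RCLike 𝕜] (m : Fin 3) (f : Pt → 𝕜) : Pt → 𝕜 :=
  fun x => fderiv ℝ f x (Pi.single m 1)

/-- `Y`-periodic functions on the whole space. -/
def IsPeriodic {𝕜 : Type} (f : Pt → 𝕜) : Prop :=
  ∀ (x : Pt) (m : Fin 3), f (x + Pi.single m 1) = f x

/-- `f` belongs to the periodic Sobolev space `H¹_#(Y; 𝕜)` and `g` is its weak gradient: the pair
`(f, ∇ f)` is the limit, in the `H¹(Y)`-norm, of smooth `Y`-periodic functions. -/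
def HasH1PerGrad {𝕜 : Type} [RCLike 𝕜] (f : Pt → 𝕜) (g : Fin 3 → Pt → 𝕜) : Prop :=
  MemLp f 2 (volume.restrict cellY) ∧
  (∀ m, MemLp (g m) 2 (volume.restrict cellY)) ∧
  ∃ φ : ℕ → Pt → 𝕜,
    (∀ k, ContDiff ℝ ∞ (φ k) ∧ IsPeriodic (φ k)) ∧
    Tendsto (fun k => eLpNorm (fun x => φ k x - f x) 2 (volume.restrict cellY)) atTop (𝓝 0) ∧
    ∀ m, Tendsto (fun k => eLpNorm (fun x => partialDeriv m (φ k) x - g m x) 2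
      (volume.restrict cellY)) atTop (𝓝 0)

/-- The vector field `v` belongs to `H¹_#(Y; 𝕜³)`, with weak gradient `Dv x m n = ∂ₘ vₙ (x)`. -/
def HasH1PerGradVec {𝕜 : Type} [RCLike 𝕜] (v : Pt → Fin 3 → 𝕜) (Dv : Pt → Mat 𝕜) : Prop :=
  ∀ n, HasH1PerGrad (fun x => v x n) (fun m x => Dv x m n)

/-- The mean over `Y` of every component of `v` vanishes (recall that `Y` has volume one). -/
def MeanZero {𝕜 : Type} [RCLike 𝕜] (v : Pt → Fin 3 → 𝕜) : Prop :=
  ∀ n, ∫ x in cellY, v x n = 0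

/-- `u` (with weak gradient `Du`) is the mean-free solution of the periodic cell problem
`⟨∇ˢ v : C : ∇ˢ u⟩ = - ⟨∇ˢ v : C⟩ : E` for all `v` in `H¹_#(Y; ℝ³)`. -/
def SolvesCellProblem (C : Pt → Tensor4) (E : Mat ℝ) (u : Pt → Fin 3 → ℝ) (Du : Pt → Mat ℝ) :
    Prop :=
  HasH1PerGradVec u Du ∧ MeanZero u ∧
  ∀ (v : Pt → Fin 3 → ℝ) (Dv : Pt → Mat ℝ), HasH1PerGradVec v Dv →
    ∫ x in cellY, ddot (symPart (Dv x)) (contract (C x) (symPart (Du x))) =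
      -∫ x in cellY, ddot (symPart (Dv x)) (contract (C x) E)

/-! Voxels and the standing assumptions on the stiffness. -/

/-- The open voxel `Y_I` of edge length `1/N`, for `I` in `I_N = {0, …, N-1}³`. -/
def voxel (N : ℕ) (I : Fin 3 → Fin N) : Set Pt :=
  Set.univ.pi fun m => Set.Ioo (((I m : ℕ) : ℝ) / N) ((((I m : ℕ) : ℝ) + 1) / N)

/-- The image-like stiffness `C_N`, equal to `Cstar I` on the voxel `Y_I`. Its values on the faces
of the voxels, a null set, are immaterial. -/
def voxelField (N : ℕ) (Cstar : (Fin 3 → Fin N) → Tensor4) : Pt → Tensor4 :=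
  fun x => ∑ I, (voxel N I).indicator (fun _ => Cstar I) x

/-- `Y` consists of the subdomains `D₀, …, D_M`, that is, it is their disjoint union up to a null
set (the interfaces), and `C` takes the constant value `Λ l` in `D l`. The `D l` may be arbitrary
open sets; in particular they may be Lipschitz subdomains. -/
structure AssumptionA {M : ℕ} (D : Fin (M + 1) → Set Pt) (Λ : Fin (M + 1) → Tensor4)
    (C : Pt → Tensor4) : Prop where
  isOpen : ∀ l, IsOpen (D l)
  subset : ∀ l, D l ⊆ cellY
  disjoint : ∀ l l', l ≠ l' → Disjoint (D l) (D l')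
  cover : volume (cellY \ ⋃ l, D l) = 0
  const : ∀ l, ∀ x ∈ D l, C x = Λ l

/-- Symmetry and coercivity of the phase tensors, with the constants `a` and `b`. -/
structure AssumptionB {M : ℕ} (Λ : Fin (M + 1) → Tensor4) (a b : ℝ) : Prop where
  lower_pos : 0 < a
  upper_pos : 0 < b
  symm_left : ∀ l m n p q, Λ l m n p q = Λ l n m p q
  symm_right : ∀ l m n p q, Λ l m n p q = Λ l m n q p
  symm_major : ∀ l m n p q, Λ l m n p q = Λ l p q m n
  lower : ∀ l (F : Mat ℝ), F.IsSymm → a * ddot F F ≤ ddot F (contract (Λ l) F)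
  upper : ∀ l (F : Mat ℝ), F.IsSymm → ddot F (contract (Λ l) F) ≤ b * ddot F F

/-- On voxels contained in one phase `Cstar` is the tensor of that phase; on every other voxel it is
the tensor of an arbitrary phase that meets the voxel. -/
structure AssumptionC {M : ℕ} (N : ℕ) (D : Fin (M + 1) → Set Pt) (Λ : Fin (M + 1) → Tensor4)
    (Cstar : (Fin 3 → Fin N) → Tensor4) : Prop where
  pure : ∀ I l, voxel N I ⊆ D l → Cstar I = Λ l
  mixed : ∀ I, (¬ ∃ l, voxel N I ⊆ D l) →
    ∃ l, (voxel N I ∩ D l).Nonempty ∧ Cstar I = Λ l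

/-! Trigonometric polynomials, and the operators `P_N`, `Q_N` and `R_N`. -/

/-- The frequencies `ξ` in `ℤ³` with `-N/2 ≤ ξₘ < N/2`. -/
def freqs (N : ℕ) : Finset (Fin 3 → ℤ) :=
  Fintype.piFinset fun _ => (Finset.Icc (-(N : ℤ)) N).filter fun k => -(N : ℤ) ≤ 2 * k ∧ 2 * k < N

/-- The exponential `exp (2 π i ξ · x)`. -/
def expo (ξ : Fin 3 → ℤ) (x : Pt) : ℂ :=
  Complex.exp (2 * Real.pi * Complex.I * ∑ m, (ξ m : ℂ) * (x m : ℂ))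

/-- The complex trigonometric polynomials with frequencies in `freqs N`. -/
def trigSpace (N : ℕ) : Set (Pt → ℂ) :=
  {f | ∃ c : (Fin 3 → ℤ) → ℂ, f = fun x => ∑ ξ ∈ freqs N, c ξ * expo ξ x}

/-- The Fourier coefficient of a function on `Y`. -/
def fourierCoef (f : Pt → ℂ) (ξ : Fin 3 → ℤ) : ℂ :=
  ∫ x in cellY, f x * expo (-ξ) x

/-- Fourier truncation, the `L²(Y)`-orthogonal projection onto `trigSpace N`. -/
def projP (N : ℕ) (f : Pt → ℂ) : Pt → ℂ :=
  fun x => ∑ ξ ∈ freqs N, fourierCoef f ξ * expo ξ x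

/-- The mollifier `N³ 𝟙_{C_N}`, where `C_N` is the cube of edge length `1/N` centred at `0`. -/
def mollifier (N : ℕ) : Pt → ℝ :=
  (Set.univ.pi fun _ : Fin 3 => Set.Icc (-(1 / (2 * (N : ℝ)))) (1 / (2 * (N : ℝ)))).indicator
    fun _ => (N : ℝ) ^ 3

/-- The `Y`-periodic extension of the restriction of `f` to `Y`. -/
def perExt (f : Pt → ℂ) : Pt → ℂ := fun x => f fun m => Int.fract (x m)

/-- `G_N * f`, the convolution of the mollifier with the periodic extension of `f`. -/
def mollify (N : ℕ) (f : Pt → ℂ) : Pt → ℂ :=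
  fun x => ∫ y, (mollifier N y : ℂ) * perExt f (x - y)

/-- `R_N f = G_N * G_N * f`. -/
def opR (N : ℕ) (f : Pt → ℂ) : Pt → ℂ := mollify N (mollify N f)

/-- The Fourier coefficients of the mollifier: the product of the factors
`N sin (π ξₘ / N) / (π ξₘ)`, read as `1` when `ξₘ = 0`. -/
def mollifierCoef (N : ℕ) (ξ : Fin 3 → ℤ) : ℝ :=
  ∏ m, if ξ m = 0 then 1 else (N : ℝ) * Real.sin (Real.pi * ξ m / N) / (Real.pi * ξ m)

/-- The discrete function of voxel averages of `f`. -/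
def voxelAvg (N : ℕ) (f : Pt → ℂ) (I : Fin 3 → Fin N) : ℂ := ⨍ x in voxel N I, f x

/-- The discrete Fourier coefficients of a function on the voxels. -/
def dft (N : ℕ) (a : (Fin 3 → Fin N) → ℂ) (ξ : Fin 3 → ℤ) : ℂ :=
  ((N : ℂ) ^ 3)⁻¹ * ∑ I, a I *
    Complex.exp (-(2 * Real.pi * Complex.I * ((∑ m, (ξ m : ℂ) * ((I m : ℕ) : ℂ)) / N)))

/-- The operator `Q_N`, a trigonometric interpolation of voxel averages. -/
def opQ (N : ℕ) (f : Pt → ℂ) : Pt → ℂ :=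
  fun x => ∑ ξ ∈ freqs N, ((mollifierCoef N ξ : ℂ))⁻¹ *
    Complex.exp (-(Real.pi * Complex.I * ((∑ m, (ξ m : ℂ)) / N))) *
      dft N (voxelAvg N f) ξ * expo ξ x

/-! The reformulated variational problem of the Moulinec–Suquet scheme. -/

/-- The classical gradient `∂ₘ vₙ` of a vector field. -/
def gradVec (v : Pt → Fin 3 → ℂ) : Pt → Mat ℂ :=
  fun x m n => partialDeriv m (fun y => v y n) x

/-- `uN` is a mean-free trigonometric polynomial with
`⟨R_N (∇ˢ v̄) : Q_N (C_N : ∇ˢ uN)⟩ = - ⟨R_N (∇ˢ v̄) : Q_N (C_N : E)⟩` for all `v` in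
`H¹_#(Y; ℂ³)`, where `v̄` is the complex conjugate of `v`. -/
def SolvesMS (N : ℕ) (Cstar : (Fin 3 → Fin N) → Tensor4) (E : Mat ℝ) (uN : Pt → Fin 3 → ℂ) :
    Prop :=
  (∀ n, (fun x => uN x n) ∈ trigSpace N) ∧ MeanZero uN ∧
  ∀ (v : Pt → Fin 3 → ℂ) (Dv : Pt → Mat ℂ), HasH1PerGradVec v Dv →
    ∫ x in cellY, ddot (entrywise (opR N) (fun y => conjMat (symPart (Dv y))) x)
        (entrywise (opQ N)
          (fun y => contract (voxelField N Cstar y) (symPart (gradVec uN y))) x) =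
      -∫ x in cellY, ddot (entrywise (opR N) (fun y => conjMat (symPart (Dv y))) x)
        (entrywise (opQ N) (fun y => contract (voxelField N Cstar y) (toC E)) x)

/-- The strain `ε = ∇ˢ u + E`, as a complex matrix field. -/
def strain (E : Mat ℝ) (Du : Pt → Mat ℝ) : Pt → Mat ℂ := fun x => toC (symPart (Du x) + E)

/-- The stress `σ = C : ε`. -/
def stress (C : Pt → Tensor4) (E : Mat ℝ) (Du : Pt → Mat ℝ) : Pt → Mat ℂ :=
  fun x => contract (C x) (strain E Du x)

end FFTHom

end

open FFTHom

open FFTHom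

/-! The scheme is a Galerkin method with a voxelwise quadrature. On a frequency `ξ`, `opR`
multiplies by the square of `mollifierCoef N ξ` and `opQ` divides by it once. The one surplus factor
is what averaging a mode over a voxel produces, so the pairing of `R_N h̄` with `Q_N f` equals the
mean over all voxels of the conjugate average of `P_N h` times the average of `f`
(`setIntegral_opR_conj_mul_opQ`). Since `C_N` is constant on each voxel, it leaves the average
(`voxelAvg_contract`), and the problem becomes a finite system in the Fourier coefficients of `uN`
(`solvesMS_trigPoly_iff`).

Stability: by Jordan's inequality the mollifier coefficients are at least `(2/π)^3` on `freqs N`.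
With the discrete Parseval identity, the mean square of the voxel averages of a strain controls its
`L²`-norm uniformly in `N` (`sum_norm_sq_strainCoef_le`). Coercivity of the tensors and Korn's
inequality mode by mode make the form definite on mean-free fields; existence and uniqueness follow
by finite-dimensional linear algebra.

Error: let `d` be the coefficients of `uN - P_N u`. The exact stress is divergence-free in every
mode, and the discrete Parseval identity keeps modes in `freqs N` apart, so the averages of `P_N σ`
are orthogonal to all discrete strains (`sum_conj_strainAvg_mul_voxelAvg_projP`). Testing the
discrete equation with `d` then leaves only voxel averages of `ε - P_N ε` (contracted with `C_N`),
`(C - C_N) : ε` and `σ - P_N σ`, which Jensen's inequality bounds by `L²`-norms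
(`sq_mul_sum_norm_sq_strainAvg_le`). Stability and a triangle-type inequality finish the proof. -/

/-! ### Complex exponentials: algebra, periodicity, derivatives -/

lemma expo_eq_prod (ξ : Fin 3 → ℤ) (x : Pt) :
    expo ξ x = ∏ m, Complex.exp (2 * Real.pi * Complex.I * (ξ m * x m)) := by
  rw [expo, Finset.mul_sum, Complex.exp_sum]

@[simp] lemma expo_zero (x : Pt) : expo 0 x = 1 := by simp [expo]

lemma expo_add (ξ η : Fin 3 → ℤ) (x : Pt) : expo (ξ + η) x = expo ξ x * expo η x := by
  simp only [expo_eq_prod, ← Finset.prod_mul_distrib, ← Complex.exp_add]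
  refine Finset.prod_congr rfl fun m _ => ?_
  congr 1
  simp only [Pi.add_apply, Int.cast_add]
  ring

lemma expo_add_right (ξ : Fin 3 → ℤ) (x y : Pt) : expo ξ (x + y) = expo ξ x * expo ξ y := by
  simp only [expo_eq_prod, ← Finset.prod_mul_distrib, ← Complex.exp_add]
  refine Finset.prod_congr rfl fun m _ => ?_
  congr 1
  simp only [Pi.add_apply, Complex.ofReal_add]
  ring

lemma conj_expo (ξ : Fin 3 → ℤ) (x : Pt) : (starRingEnd ℂ) (expo ξ x) = expo (-ξ) x := by
  rw [expo, expo, ← Complex.exp_conj]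
  congr 1
  simp [Finset.mul_sum, Complex.conj_ofNat]

lemma norm_expo (ξ : Fin 3 → ℤ) (x : Pt) : ‖expo ξ x‖ = 1 := by
  have h : 2 * Real.pi * Complex.I * ∑ m, (ξ m : ℂ) * (x m : ℂ) =
      ((2 * Real.pi * ∑ m, (ξ m : ℝ) * x m : ℝ) : ℂ) * Complex.I := by
    push_cast; ring
  rw [expo, h, Complex.norm_exp_ofReal_mul_I]

lemma contDiff_expo (ξ : Fin 3 → ℤ) : ContDiff ℝ ∞ (expo ξ) := by
  unfold expo
  refine ContDiff.cexp (contDiff_const.mul (ContDiff.sum fun m _ => contDiff_const.mul ?_))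
  exact Complex.ofRealCLM.contDiff.comp (contDiff_apply ℝ ℝ m)

lemma continuous_expo (ξ : Fin 3 → ℤ) : Continuous (expo ξ) := (contDiff_expo ξ).continuous

lemma exp_two_pi_mul_int (k : ℤ) : Complex.exp (2 * Real.pi * Complex.I * k) = 1 := by
  rw [mul_comm]
  exact Complex.exp_int_mul_two_pi_mul_I k

lemma expo_int (ξ k : Fin 3 → ℤ) : expo ξ (fun m => (k m : ℝ)) = 1 := by
  rw [expo_eq_prod]
  refine Finset.prod_eq_one fun m _ => ?_
  rw [← exp_two_pi_mul_int (ξ m * k m)]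
  push_cast
  rfl

lemma expo_add_int (ξ k : Fin 3 → ℤ) (x : Pt) : expo ξ (x + fun m => (k m : ℝ)) = expo ξ x := by
  rw [expo_add_right, expo_int, mul_one]

lemma isPeriodic_expo (ξ : Fin 3 → ℤ) : IsPeriodic (expo ξ) := by
  intro x m
  rw [← expo_add_int ξ (Pi.single m 1) x]
  congr 2
  ext j
  by_cases h : j = m
  · subst h; simp
  · simp [Pi.single_eq_of_ne h]

lemma hasFDerivAt_expo (ξ : Fin 3 → ℤ) (x : Pt) :
    HasFDerivAt (expo ξ) ((expo ξ x) • ((2 * Real.pi * Complex.I) •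
      ∑ m, (ξ m : ℂ) • Complex.ofRealCLM.comp
        (ContinuousLinearMap.proj (R := ℝ) (φ := fun _ : Fin 3 => ℝ) m))) x := by
  unfold expo
  refine HasFDerivAt.cexp (HasFDerivAt.const_mul (HasFDerivAt.fun_sum fun m _ => ?_) _)
  refine HasFDerivAt.const_mul ?_ _
  exact (Complex.ofRealCLM.comp
    (ContinuousLinearMap.proj (R := ℝ) (φ := fun _ : Fin 3 => ℝ) m)).hasFDerivAt

lemma partialDeriv_expo (ξ : Fin 3 → ℤ) (m : Fin 3) (x : Pt) :
    partialDeriv m (expo ξ) x = 2 * Real.pi * Complex.I * ξ m * expo ξ x := by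
  rw [partialDeriv, (hasFDerivAt_expo ξ x).fderiv]
  have hs : ∑ j, (ξ j : ℂ) * ((if j = m then (1 : ℝ) else 0 : ℝ) : ℂ) = ξ m := by
    rw [Finset.sum_eq_single m (fun j _ hj => by simp [hj]) (by simp)]
    simp
  simp [Pi.single_apply, hs]
  ring

/-! ### Integrals of exponentials over boxes -/

/-- Parametrising the interval by midpoint and half-length separates a pure phase from a real sinc
factor that does not depend on the position. -/
lemma intervalIntegral_exp_int (k : ℤ) (c h : ℝ) :
    ∫ t in (c - h)..(c + h), Complex.exp (2 * Real.pi * Complex.I * (k * t)) =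
      Complex.exp (2 * Real.pi * Complex.I * (k * c)) *
        ((if k = 0 then 2 * h else Real.sin (2 * Real.pi * k * h) / (Real.pi * k) : ℝ) : ℂ) := by
  split_ifs with hk
  · subst hk
    simp
    ring
  · have hk' : (k : ℂ) ≠ 0 := by exact_mod_cast hk
    have hp : (Real.pi : ℂ) ≠ 0 := by exact_mod_cast Real.pi_ne_zero
    have hne : 2 * Real.pi * Complex.I * k ≠ 0 := by simp [hk', hp]
    simp only [← mul_assoc (2 * Real.pi * Complex.I)]
    rw [integral_exp_mul_complex hne]
    push_cast
    rw [Complex.sin]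
    have e1 : 2 * Real.pi * Complex.I * k * ((c : ℂ) + h) =
      2 * Real.pi * Complex.I * k * c + 2 * Real.pi * k * h * Complex.I := by ring
    have e2 : 2 * Real.pi * Complex.I * k * ((c : ℂ) - h) =
      2 * Real.pi * Complex.I * k * c + -(2 * Real.pi * k * h) * Complex.I := by ring
    rw [e1, e2, Complex.exp_add, Complex.exp_add]
    field_simp
    ring_nf
    rw [Complex.I_sq]
    ring

/-- Fubini for a product of one-variable exponentials. It serves the unit cell (`h = 1/2`), and the
voxels and the mollifier cube (`h = 1/(2N)`). -/
lemma setIntegral_expo_box (ξ : Fin 3 → ℤ) (c : Pt) {h : ℝ} (hh : 0 ≤ h) :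
    ∫ x in Set.univ.pi fun m => Set.Ioo (c m - h) (c m + h), expo ξ x =
      expo ξ c * ((∏ m, if ξ m = 0 then 2 * h else
        Real.sin (2 * Real.pi * ξ m * h) / (Real.pi * ξ m) : ℝ) : ℂ) := by
  rw [volume_pi, Measure.restrict_pi_pi]
  simp only [expo_eq_prod]
  rw [integral_fintype_prod_eq_prod
    (f := fun m (t : ℝ) => Complex.exp (2 * Real.pi * Complex.I * (ξ m * t)))]
  rw [Complex.ofReal_prod, ← Finset.prod_mul_distrib]
  refine Finset.prod_congr rfl fun m _ => ?_
  rw [← integral_Ioc_eq_integral_Ioo, ← intervalIntegral.integral_of_le (by linarith),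
    intervalIntegral_exp_int]

/-! ### The unit cell and orthogonality of the exponentials -/

lemma cellY_eq_box : cellY =
    Set.univ.pi fun _ : Fin 3 => Set.Ioo ((1 / 2 : ℝ) - 1 / 2) (1 / 2 + 1 / 2) := by
  norm_num [cellY]

lemma measurableSet_cellY : MeasurableSet cellY :=
  MeasurableSet.univ_pi fun _ => measurableSet_Ioo

lemma volume_cellY : volume cellY = 1 := by
  rw [cellY, Real.volume_pi_Ioo]
  simp

instance isProbabilityMeasure_cellY : IsProbabilityMeasure (volume.restrict cellY) :=
  ⟨by rw [Measure.restrict_apply_univ, volume_cellY]⟩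

lemma setIntegral_expo_cellY (ξ : Fin 3 → ℤ) :
    ∫ x in cellY, expo ξ x = if ξ = 0 then 1 else 0 := by
  split_ifs with h
  · subst h
    simp [Measure.real]
  · rw [cellY_eq_box, setIntegral_expo_box ξ (fun _ => 1 / 2) (by norm_num)]
    obtain ⟨m, hm⟩ : ∃ m, ξ m ≠ 0 := by
      by_contra! hc
      exact h (funext hc)
    rw [Finset.prod_eq_zero (Finset.mem_univ m), Complex.ofReal_zero, mul_zero]
    rw [if_neg hm, show 2 * Real.pi * ξ m * (1 / 2) = ξ m * Real.pi by ring, Real.sin_int_mul_pi,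
      zero_div]

/-! ### Voxels and the mollifier coefficients -/

/-- The centre of the voxel `Y_I`. -/
noncomputable def voxelCentre (N : ℕ) (I : Fin 3 → Fin N) : Pt :=
  fun m => (((I m : ℕ) : ℝ) + 1 / 2) / N

lemma voxel_eq_box (N : ℕ) (I : Fin 3 → Fin N) : voxel N I =
    Set.univ.pi fun m => Set.Ioo (voxelCentre N I m - 1 / (2 * N))
      (voxelCentre N I m + 1 / (2 * N)) := by
  rw [voxel]
  congr 1
  ext1 m
  have : (N : ℝ) ≠ 0 := by
    have := (I m).pos
    positivity
  congr 1 <;> (rw [voxelCentre]; field_simp; ring)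

lemma measurableSet_voxel (N : ℕ) (I : Fin 3 → Fin N) : MeasurableSet (voxel N I) :=
  MeasurableSet.univ_pi fun _ => measurableSet_Ioo

lemma volume_voxel (N : ℕ) (I : Fin 3 → Fin N) : volume.real (voxel N I) = ((N : ℝ) ^ 3)⁻¹ := by
  rw [Measure.real, voxel, Real.volume_pi_Ioo]
  have (m : Fin 3) : (((I m : ℕ) : ℝ) + 1) / N - ((I m : ℕ) : ℝ) / N = (N : ℝ)⁻¹ := by ring
  simp only [this, Finset.prod_const, Finset.card_univ, Fintype.card_fin]
  rw [ENNReal.toReal_pow, ENNReal.toReal_ofReal (by positivity), inv_pow]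

lemma voxelAvg_eq {N : ℕ} (f : Pt → ℂ) (I : Fin 3 → Fin N) :
    voxelAvg N f I = (N : ℂ) ^ 3 * ∫ x in voxel N I, f x := by
  rw [voxelAvg, setAverage_eq, volume_voxel, inv_inv, Complex.real_smul]
  push_cast
  rfl

lemma mollifierCoef_eq {N : ℕ} (hN : 0 < N) (ξ : Fin 3 → ℤ) :
    mollifierCoef N ξ = (N : ℝ) ^ 3 * ∏ m, if ξ m = 0 then 2 * (1 / (2 * (N : ℝ))) else
        Real.sin (2 * Real.pi * ξ m * (1 / (2 * N))) / (Real.pi * ξ m) := by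
  have hN' : (N : ℝ) ≠ 0 := by positivity
  have : (N : ℝ) ^ 3 = ∏ _m : Fin 3, (N : ℝ) := by simp
  rw [this, ← Finset.prod_mul_distrib, mollifierCoef]
  refine Finset.prod_congr rfl fun m _ => ?_
  split_ifs with h
  · field_simp
  · rw [show 2 * Real.pi * ξ m * (1 / (2 * N)) = Real.pi * ξ m / N by field_simp]
    ring

/-- A voxel is a translate of the support of the mollifier, up to a null set, so averaging over it
amounts to mollifying and sampling at the centre. -/
lemma voxelAvg_expo {N : ℕ} (hN : 0 < N) (ξ : Fin 3 → ℤ) (I : Fin 3 → Fin N) :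
    voxelAvg N (expo ξ) I = mollifierCoef N ξ * expo ξ (voxelCentre N I) := by
  rw [voxelAvg_eq, voxel_eq_box, setIntegral_expo_box _ _ (by positivity), mollifierCoef_eq hN]
  push_cast
  ring

lemma integral_mollifier_mul_expo {N : ℕ} (hN : 0 < N) (ξ : Fin 3 → ℤ) :
    ∫ y, (mollifier N y : ℂ) * expo ξ y = mollifierCoef N ξ := by
  have h1 : (fun y => (mollifier N y : ℂ) * expo ξ y) =
      (Set.univ.pi fun _ : Fin 3 => Set.Icc (-(1 / (2 * (N : ℝ)))) (1 / (2 * (N : ℝ)))).indicator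
        (fun y => (N : ℂ) ^ 3 * expo ξ y) := by
    ext y
    by_cases hy : y ∈ Set.univ.pi
      fun _ : Fin 3 => Set.Icc (-(1 / (2 * (N : ℝ)))) (1 / (2 * (N : ℝ)))
    · simp only [mollifier, Set.indicator_of_mem hy]
      push_cast; rfl
    · simp only [mollifier, Set.indicator_of_notMem hy]
      simp
  rw [h1, integral_indicator (MeasurableSet.univ_pi fun _ => measurableSet_Icc)]
  have h2 : (Set.univ.pi fun _ : Fin 3 => Set.Icc (-(1 / (2 * (N : ℝ)))) (1 / (2 * (N : ℝ))))
      =ᵐ[volume] (Set.univ.pi fun m : Fin 3 => Set.Ioo ((0 : Pt) m - 1 / (2 * (N : ℝ)))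
        ((0 : Pt) m + 1 / (2 * (N : ℝ)))) := by
    simp only [Pi.zero_apply, zero_sub, zero_add]
    rw [Set.pi_univ_Icc]
    exact Measure.univ_pi_Ioo_ae_eq_Icc.symm
  rw [setIntegral_congr_set h2, integral_const_mul, setIntegral_expo_box _ _ (by positivity),
    mollifierCoef_eq hN]
  have : expo ξ 0 = 1 := by simp [expo]
  rw [this]
  push_cast
  ring

lemma abs_le_of_mem_freqs {N : ℕ} {ξ : Fin 3 → ℤ} (hξ : ξ ∈ freqs N) (m : Fin 3) :
    |(2 * ξ m : ℝ)| ≤ N := by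
  have := (Finset.mem_filter.1 (Fintype.mem_piFinset.1 hξ m)).2
  rw [abs_le]
  constructor <;> · exact_mod_cast (by omega)

lemma zero_mem_freqs {N : ℕ} (hN : 0 < N) : (0 : Fin 3 → ℤ) ∈ freqs N := by
  simp [freqs, hN]

/-- Jordan's inequality `sin t ≥ 2t/π` on `[0, π/2]`, applied in each coordinate at `t = π|ξ m|/N`.
This is the source of stability uniform in `N`. -/
lemma two_div_pi_pow_le_mollifierCoef {N : ℕ} (hN : 0 < N) {ξ : Fin 3 → ℤ} (hξ : ξ ∈ freqs N) :
    (2 / Real.pi) ^ 3 ≤ mollifierCoef N ξ := by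
  have hc : (2 / Real.pi : ℝ) ^ 3 = ∏ _m : Fin 3, (2 / Real.pi : ℝ) := by simp [div_pow]
  have hpi := Real.pi_pos
  have hN' : (0 : ℝ) < N := by positivity
  rw [hc, mollifierCoef]
  refine Finset.prod_le_prod (fun _ _ => by positivity) fun m _ => ?_
  split_ifs with h
  · rw [div_le_one hpi]
    exact Real.two_le_pi
  · have hb := abs_le_of_mem_freqs hξ m
    have key : ∀ t : ℝ, 0 < t → 2 * t ≤ N →
        2 / Real.pi ≤ N * Real.sin (Real.pi * t / N) / (Real.pi * t) := by
      intro t ht htN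
      have := Real.mul_le_sin (x := Real.pi * t / N) (by positivity)
        (by rw [div_le_div_iff₀ hN' two_pos]; nlinarith)
      rw [le_div_iff₀ (by positivity)]
      calc 2 / Real.pi * (Real.pi * t) = N * (2 / Real.pi * (Real.pi * t / N)) := by field_simp
        _ ≤ _ := by gcongr
    -- Each factor is even in `ξ m`, so a negative frequency reduces to a positive one.
    rcases lt_or_gt_of_ne h with h0 | h0
    · have h0' : (0 : ℝ) < -(ξ m : ℝ) := by
        have : (ξ m : ℝ) < 0 := by exact_mod_cast h0
        linarith
      have := key (-(ξ m : ℝ)) h0' (by rw [abs_le] at hb; linarith)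
      rwa [mul_neg, neg_div, Real.sin_neg, mul_neg, neg_div_neg_eq] at this
    · exact key _ (by exact_mod_cast h0) (by rw [abs_le] at hb; linarith)

lemma mollifierCoef_pos {N : ℕ} (hN : 0 < N) {ξ : Fin 3 → ℤ} (hξ : ξ ∈ freqs N) :
    0 < mollifierCoef N ξ :=
  lt_of_lt_of_le (by have := Real.pi_pos; positivity) (two_div_pi_pow_le_mollifierCoef hN hξ)

/-! ### Trigonometric polynomials and their voxel averages -/

/-- The trigonometric polynomial with coefficients `c`. -/
noncomputable def trigPoly (N : ℕ) (c : (Fin 3 → ℤ) → ℂ) : Pt → ℂ :=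
  fun x => ∑ ξ ∈ freqs N, c ξ * expo ξ x

lemma contDiff_trigPoly (N : ℕ) (c : (Fin 3 → ℤ) → ℂ) : ContDiff ℝ ∞ (trigPoly N c) :=
  ContDiff.sum fun ξ _ => contDiff_const.mul (contDiff_expo ξ)

lemma isPeriodic_trigPoly (N : ℕ) (c : (Fin 3 → ℤ) → ℂ) : IsPeriodic (trigPoly N c) := by
  intro x m
  simp only [trigPoly]
  refine Finset.sum_congr rfl fun ξ _ => ?_
  rw [isPeriodic_expo ξ x m]

lemma partialDeriv_trigPoly (N : ℕ) (c : (Fin 3 → ℤ) → ℂ) (m : Fin 3) :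
    partialDeriv m (trigPoly N c) =
      trigPoly N fun ξ => 2 * Real.pi * Complex.I * ξ m * c ξ := by
  ext x
  have h (ξ : Fin 3 → ℤ) : HasFDerivAt (fun x => c ξ * expo ξ x) (c ξ • fderiv ℝ (expo ξ) x) x :=
    ((hasFDerivAt_expo ξ x).differentiableAt.hasFDerivAt).const_mul _
  have h2 : HasFDerivAt (trigPoly N c) (∑ ξ ∈ freqs N, c ξ • fderiv ℝ (expo ξ) x) x :=
    HasFDerivAt.fun_sum fun ξ _ => h ξ
  rw [partialDeriv, h2.fderiv, trigPoly, sum_apply]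
  refine Finset.sum_congr rfl fun ξ _ => ?_
  have := partialDeriv_expo ξ m x
  rw [partialDeriv] at this
  rw [smul_apply, this, smul_eq_mul]
  ring

lemma trigPoly_add (N : ℕ) (a b : (Fin 3 → ℤ) → ℂ) (x : Pt) :
    trigPoly N a x + trigPoly N b x = trigPoly N (fun ξ => a ξ + b ξ) x := by
  simp only [trigPoly, ← Finset.sum_add_distrib, add_mul]

lemma trigPoly_sub (N : ℕ) (a b : (Fin 3 → ℤ) → ℂ) (x : Pt) :
    trigPoly N a x - trigPoly N b x = trigPoly N (fun ξ => a ξ - b ξ) x := by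
  simp only [trigPoly, ← Finset.sum_sub_distrib, sub_mul]

lemma integrableOn_of_continuous {E : Type*} [NormedAddCommGroup E] {f : Pt → E}
    (hf : Continuous f) : IntegrableOn f cellY := by
  have h : IntegrableOn f (Set.Icc (0 : Pt) 1) := hf.continuousOn.integrableOn_compact isCompact_Icc
  refine h.mono_set fun x hx => ?_
  exact ⟨fun m => (hx m trivial).1.le, fun m => (hx m trivial).2.le⟩

lemma voxel_subset_cellY {N : ℕ} (I : Fin 3 → Fin N) : voxel N I ⊆ cellY := by
  intro x hx m _
  have h := hx m trivial
  have hN : (0 : ℝ) < N := by exact_mod_cast (I m).pos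
  have hI : ((I m : ℕ) : ℝ) + 1 ≤ N := by exact_mod_cast (I m).2
  exact ⟨lt_of_le_of_lt (by positivity) h.1, h.2.trans_le ((div_le_one hN).2 hI)⟩

lemma voxelAvg_trigPoly {N : ℕ} (hN : 0 < N) (c : (Fin 3 → ℤ) → ℂ) (I : Fin 3 → Fin N) :
    voxelAvg N (trigPoly N c) I =
      ∑ ξ ∈ freqs N, c ξ * (mollifierCoef N ξ * expo ξ (voxelCentre N I)) := by
  have hi (ξ : Fin 3 → ℤ) : IntegrableOn (expo ξ) (voxel N I) :=
    (integrableOn_of_continuous (continuous_expo ξ)).mono_set (voxel_subset_cellY I)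
  rw [voxelAvg_eq]
  simp only [trigPoly]
  rw [integral_finsetSum _ fun ξ _ => (hi ξ).const_mul _, Finset.mul_sum]
  refine Finset.sum_congr rfl fun ξ _ => ?_
  rw [integral_const_mul, ← voxelAvg_expo hN, voxelAvg_eq]
  ring

/-- A geometric sum over powers of an `N`-th root of unity, which is not `1` because `N` does not
divide `k`. The half-voxel offset of the centres is a common phase. -/
lemma sum_exp_voxelCentre_eq_zero {N : ℕ} (hN : 0 < N) {k : ℤ} (hk : k ≠ 0) (hkN : |k| < N) :
    ∑ j : Fin N, Complex.exp
      (2 * Real.pi * Complex.I * (k * (((((j : ℕ) : ℝ) + 1 / 2) / N : ℝ) : ℂ))) = 0 := by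
  have hN' : (N : ℂ) ≠ 0 := by exact_mod_cast hN.ne'
  set z := Complex.exp (2 * Real.pi * Complex.I * (k / N)) with hz
  have hterm (j : ℕ) : Complex.exp
      (2 * Real.pi * Complex.I * (k * (((((j : ℕ) : ℝ) + 1 / 2) / N : ℝ) : ℂ))) =
      Complex.exp (Real.pi * Complex.I * k / N) * z ^ j := by
    rw [hz, ← Complex.exp_nat_mul, ← Complex.exp_add]
    congr 1
    push_cast
    field_simp
    ring
  simp only [hterm]
  rw [← Finset.mul_sum, Fin.sum_univ_eq_sum_range (fun j => z ^ j)]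
  have hzN : z ^ N = 1 := by
    rw [hz, ← Complex.exp_nat_mul, ← exp_two_pi_mul_int k]
    congr 1
    field_simp
  have hz1 : z ≠ 1 := by
    intro h
    obtain ⟨n, hn⟩ := Complex.exp_eq_one_iff.1 h
    have h2 : (k : ℂ) = n * N := by
      have h3 : (2 * Real.pi * Complex.I) * (k / N) = (2 * Real.pi * Complex.I) * n := by
        rw [hn]; ring
      have := mul_left_cancel₀ Complex.two_pi_I_ne_zero h3
      field_simp at this
      rw [this]
      ring
    have h3 : k = n * N := by exact_mod_cast h2
    have hn0 : n ≠ 0 := by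
      rintro rfl
      simp at h3
      exact hk h3
    have : (N : ℤ) ≤ |k| := by
      rw [h3, abs_mul, Nat.abs_cast]
      nlinarith [Int.one_le_abs hn0]
    omega
  have := geom_sum_mul z N
  rw [hzN, sub_self, mul_eq_zero] at this
  rw [this.resolve_right (sub_ne_zero.2 hz1), mul_zero]

lemma sum_expo_voxelCentre {N : ℕ} (hN : 0 < N) {ξ : Fin 3 → ℤ} (hξ : ∀ m, |ξ m| < N) :
    ((N : ℂ) ^ 3)⁻¹ * ∑ I : Fin 3 → Fin N, expo ξ (voxelCentre N I) = if ξ = 0 then 1 else 0 := by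
  have hN' : (N : ℂ) ≠ 0 := by exact_mod_cast hN.ne'
  split_ifs with h
  · subst h
    simp [hN']
  · obtain ⟨m, hm⟩ : ∃ m, ξ m ≠ 0 := by
      by_contra! hc
      exact h (funext hc)
    simp only [expo_eq_prod, voxelCentre]
    rw [← Fintype.prod_sum (fun m (j : Fin N) => Complex.exp
      (2 * Real.pi * Complex.I * (ξ m * (((((j : ℕ) : ℝ) + 1 / 2) / N : ℝ) : ℂ))))]
    rw [Finset.prod_eq_zero (Finset.mem_univ m) (sum_exp_voxelCentre_eq_zero hN hm (hξ m)),
      mul_zero]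

/-- No aliasing within `freqs N`. The range is half-open, which matters for even `N`, where `-N/2`
and `N/2` agree on the grid up to a constant phase. -/
lemma abs_sub_lt_of_mem_freqs {N : ℕ} {ξ η : Fin 3 → ℤ} (hξ : ξ ∈ freqs N) (hη : η ∈ freqs N)
    (m : Fin 3) : |(ξ - η) m| < N := by
  have h1 := (Finset.mem_filter.1 (Fintype.mem_piFinset.1 hξ m)).2
  have h2 := (Finset.mem_filter.1 (Fintype.mem_piFinset.1 hη m)).2
  rw [Pi.sub_apply, abs_lt]
  constructor <;> omega

/-- Discrete Parseval identity for the voxel averages of trigonometric polynomials. -/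
lemma sum_conj_voxelAvg_mul_voxelAvg {N : ℕ} (hN : 0 < N) (a b : (Fin 3 → ℤ) → ℂ) :
    ((N : ℂ) ^ 3)⁻¹ * ∑ I, (starRingEnd ℂ) (voxelAvg N (trigPoly N a) I) *
      voxelAvg N (trigPoly N b) I =
    ∑ ξ ∈ freqs N, (mollifierCoef N ξ : ℂ) ^ 2 * ((starRingEnd ℂ) (a ξ) * b ξ) := by
  simp only [voxelAvg_trigPoly hN, map_sum, map_mul, Complex.conj_ofReal, conj_expo,
    Finset.sum_mul_sum]
  rw [Finset.sum_comm, Finset.mul_sum]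
  refine Finset.sum_congr rfl fun ξ hξ => ?_
  rw [Finset.sum_comm, Finset.mul_sum, Finset.sum_eq_single ξ]
  · have (I : Fin 3 → Fin N) : (starRingEnd ℂ) (a ξ) * (mollifierCoef N ξ *
        expo (-ξ) (voxelCentre N I)) * (b ξ * (mollifierCoef N ξ * expo ξ (voxelCentre N I))) =
        (mollifierCoef N ξ : ℂ) ^ 2 * ((starRingEnd ℂ) (a ξ) * b ξ) := by
      have h : expo (-ξ) (voxelCentre N I) * expo ξ (voxelCentre N I) = 1 := by
        rw [← expo_add]; simp
      linear_combination ((mollifierCoef N ξ : ℂ) ^ 2 * ((starRingEnd ℂ) (a ξ) * b ξ)) * h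
    have hN' : (N : ℂ) ≠ 0 := by exact_mod_cast hN.ne'
    simp only [this]
    simp [hN']
  · intro η hη hne
    have (I : Fin 3 → Fin N) : (starRingEnd ℂ) (a ξ) * (mollifierCoef N ξ *
        expo (-ξ) (voxelCentre N I)) * (b η * (mollifierCoef N η * expo η (voxelCentre N I))) =
        (starRingEnd ℂ) (a ξ) * mollifierCoef N ξ * b η * mollifierCoef N η *
          expo (η - ξ) (voxelCentre N I) := by
      rw [sub_eq_add_neg, expo_add]; ring
    simp only [this]
    rw [← Finset.mul_sum, mul_left_comm, sum_expo_voxelCentre hN (abs_sub_lt_of_mem_freqs hη hξ),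
      if_neg (sub_ne_zero.2 hne), mul_zero]
  · exact fun h => absurd hξ h

lemma setIntegral_trigPoly {N : ℕ} (hN : 0 < N) (c : (Fin 3 → ℤ) → ℂ) :
    ∫ x in cellY, trigPoly N c x = c 0 := by
  have hi (ξ : Fin 3 → ℤ) : IntegrableOn (expo ξ) cellY :=
    integrableOn_of_continuous (continuous_expo ξ)
  simp only [trigPoly]
  rw [integral_finsetSum _ fun ξ _ => (hi ξ).const_mul _]
  simp only [integral_const_mul, setIntegral_expo_cellY]
  simp [zero_mem_freqs hN]

/-- Parseval identity for trigonometric polynomials. -/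
lemma setIntegral_norm_sq_trigPoly (N : ℕ) (c : (Fin 3 → ℤ) → ℂ) :
    ∫ x in cellY, ‖trigPoly N c x‖ ^ 2 = ∑ ξ ∈ freqs N, ‖c ξ‖ ^ 2 := by
  have hi (ξ : Fin 3 → ℤ) : IntegrableOn (expo ξ) cellY :=
    integrableOn_of_continuous (continuous_expo ξ)
  have h (x : Pt) : ((‖trigPoly N c x‖ ^ 2 : ℝ) : ℂ) = ∑ ξ ∈ freqs N, ∑ η ∈ freqs N,
      ((starRingEnd ℂ) (c ξ) * c η) * expo (η - ξ) x := by
    push_cast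
    rw [← Complex.conj_mul']
    simp only [trigPoly, map_sum, map_mul, conj_expo, Finset.sum_mul_sum]
    refine Finset.sum_congr rfl fun ξ _ => Finset.sum_congr rfl fun η _ => ?_
    rw [sub_eq_add_neg, expo_add]
    ring
  apply Complex.ofReal_injective
  rw [← integral_complex_ofReal]
  simp only [h]
  rw [integral_finsetSum _ fun ξ _ => integrable_finsetSum _ fun η _ => (hi _).const_mul _]
  push_cast
  refine Finset.sum_congr rfl fun ξ hξ => ?_
  rw [integral_finsetSum _ fun η _ => (hi _).const_mul _, Finset.sum_eq_single ξ]
  · rw [integral_const_mul, setIntegral_expo_cellY, sub_self, if_pos rfl, mul_one,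
      Complex.conj_mul']
  · intro η _ hne
    rw [integral_const_mul, setIntegral_expo_cellY, if_neg (sub_ne_zero.2 hne), mul_zero]
  · exact fun h => absurd hξ h

section PeriodicExtension

open scoped Pointwise

/-! ### Periodic extensions and integrals over translated cells -/

/-- The lattice `ℤ³` in `ℝ³`. -/
noncomputable abbrev intLattice : AddSubgroup Pt :=
  (Submodule.span ℤ (Set.range (Pi.basisFun ℝ (Fin 3)))).toAddSubgroup

/-- The half-open unit cell. -/
noncomputable abbrev halfOpenCell : Set Pt := ZSpan.fundamentalDomain (Pi.basisFun ℝ (Fin 3))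

lemma halfOpenCell_ae_eq : halfOpenCell =ᵐ[volume] cellY := by
  rw [halfOpenCell, ZSpan.fundamentalDomain_pi_basisFun, cellY]
  exact Measure.univ_pi_Ico_ae_eq_Icc.trans Measure.univ_pi_Ioo_ae_eq_Icc.symm

lemma isAddFundamentalDomain_halfOpenCell :
    IsAddFundamentalDomain intLattice halfOpenCell (volume : Measure Pt) :=
  ZSpan.isAddFundamentalDomain' _ _

lemma isAddFundamentalDomain_vadd (y : Pt) :
    IsAddFundamentalDomain intLattice (y +ᵥ halfOpenCell) (volume : Measure Pt) := by
  have : VAddCommClass Pt intLattice Pt := ⟨fun a b c => add_left_comm a (b : Pt) c⟩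
  exact isAddFundamentalDomain_halfOpenCell.vadd_of_comm y

lemma exists_int_of_mem_intLattice (g : intLattice) :
    ∃ k : Fin 3 → ℤ, (g : Pt) = fun m => (k m : ℝ) := by
  have := (Module.Basis.mem_span_iff_repr_mem ℤ (Pi.basisFun ℝ (Fin 3)) (g : Pt)).1 g.2
  choose k hk using this
  exact ⟨k, funext fun m => by simpa using (hk m).symm⟩

instance countable_intLattice : Countable intLattice := by
  choose k hk using exists_int_of_mem_intLattice
  refine Function.Injective.countable (f := k) fun g g' h => ?_
  ext1
  rw [hk g, hk g', h]

lemma perExt_vadd (f : Pt → ℂ) (g : intLattice) (x : Pt) : perExt f (g +ᵥ x) = perExt f x := by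
  obtain ⟨k, hk⟩ := exists_int_of_mem_intLattice g
  have : g +ᵥ x = (g : Pt) + x := rfl
  rw [this, hk, perExt, perExt]
  simp

lemma perExt_eq_of_mem (f : Pt → ℂ) {x : Pt} (hx : x ∈ cellY) : perExt f x = f x := by
  rw [perExt]
  congr 1
  ext m
  have := hx m trivial
  exact Int.fract_eq_self.2 ⟨this.1.le, this.2⟩

lemma expo_vadd (ξ : Fin 3 → ℤ) (g : intLattice) (x : Pt) : expo ξ (g +ᵥ x) = expo ξ x := by
  obtain ⟨k, hk⟩ := exists_int_of_mem_intLattice g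
  have : g +ᵥ x = x + (g : Pt) := add_comm _ _
  rw [this, hk, expo_add_int]

/-- The cell and its translate by `-y` are both fundamental domains of the lattice up to null sets,
and a lattice-periodic function has the same integral over either. -/
lemma setIntegral_cellY_sub {E : Type*} [NormedAddCommGroup E] [NormedSpace ℝ E] (F : Pt → E)
    (hF : ∀ (g : intLattice) x, F (g +ᵥ x) = F x) (y : Pt) :
    ∫ x in cellY, F (x - y) = ∫ x in cellY, F x := by
  rw [← setIntegral_congr_set halfOpenCell_ae_eq, ← setIntegral_congr_set halfOpenCell_ae_eq,
    (isAddFundamentalDomain_halfOpenCell).setIntegral_eq (isAddFundamentalDomain_vadd (-y)) hF]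
  have h := (measurePreserving_sub_right (volume : Measure Pt) y).setIntegral_preimage_emb
    (MeasurableEquiv.subRight y).measurableEmbedding F (-y +ᵥ halfOpenCell)
  rw [← h]
  congr 2
  ext x
  rw [Set.mem_preimage, Set.mem_vadd_set_iff_neg_vadd_mem]
  simp

lemma integrableOn_cellY_sub {E : Type*} [NormedAddCommGroup E] (F : Pt → E)
    (hF : ∀ (g : intLattice) x, F (g +ᵥ x) = F x) (hi : IntegrableOn F cellY) (y : Pt) :
    IntegrableOn (fun x => F (x - y)) cellY := by
  rw [← integrableOn_congr_set_ae halfOpenCell_ae_eq] at hi ⊢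
  rw [(isAddFundamentalDomain_halfOpenCell).integrableOn_iff (isAddFundamentalDomain_vadd (-y)) hF]
    at hi
  have h := (measurePreserving_sub_right (volume : Measure Pt) y).integrableOn_comp_preimage
    (MeasurableEquiv.subRight y).measurableEmbedding (f := F) (s := -y +ᵥ halfOpenCell)
  convert! h.2 hi using 1
  ext x
  rw [Set.mem_preimage, Set.mem_vadd_set_iff_neg_vadd_mem]
  simp

lemma integrableOn_perExt {f : Pt → ℂ} (hf : IntegrableOn f cellY) :
    IntegrableOn (perExt f) cellY :=
  hf.congr_fun (fun _ hx => (perExt_eq_of_mem f hx).symm) measurableSet_cellY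

/-- Extend a measurable representative periodically. The set where the two extensions differ is
lattice-invariant and null in one fundamental domain, hence null. -/
lemma aestronglyMeasurable_perExt {f : Pt → ℂ}
    (hf : AEStronglyMeasurable f (volume.restrict cellY)) :
    AEStronglyMeasurable (perExt f) volume := by
  obtain ⟨f', hf', hff'⟩ := hf
  refine ⟨perExt f', ?_, ?_⟩
  · exact hf'.comp_measurable (measurable_pi_lambda _ fun m => measurable_fract.comp
      (measurable_pi_apply m))
  · refine isAddFundamentalDomain_halfOpenCell.measure_zero_of_invariant
      {x | perExt f x = perExt f' x}ᶜ (fun g => ?_) ?_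
    · ext x
      rw [Set.mem_vadd_set_iff_neg_vadd_mem]
      simp [perExt_vadd]
    · rw [measure_congr ((ae_eq_refl _).inter halfOpenCell_ae_eq),
        ← Measure.restrict_apply' measurableSet_cellY]
      filter_upwards [hff', ae_restrict_mem measurableSet_cellY] with x hx hxY
      simpa [perExt_eq_of_mem _ hxY] using hx

/-! ### The mollification as a Fourier multiplier -/

lemma measurable_mollifier (N : ℕ) : Measurable (mollifier N) :=
  measurable_const.indicator (MeasurableSet.univ_pi fun _ => measurableSet_Icc)

lemma integrable_mollifier (N : ℕ) : Integrable (mollifier N) := by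
  rw [mollifier, integrable_indicator_iff (MeasurableSet.univ_pi fun _ => measurableSet_Icc)]
  refine integrableOn_const ?_
  rw [Set.pi_univ_Icc]
  exact isCompact_Icc.measure_ne_top

/-- Tonelli: by periodicity the norm of `perExt f (x - y)` has the same integral over the cell for
every `y`, which leaves the integrable mollifier. This licenses Fubini below. -/
lemma integrable_mollify_integrand (N : ℕ) {f : Pt → ℂ} (hf : IntegrableOn f cellY) :
    Integrable (fun p : Pt × Pt => (mollifier N p.2 : ℂ) * perExt f (p.1 - p.2))
      ((volume.restrict cellY).prod volume) := by
  have hm : AEStronglyMeasurable (fun p : Pt × Pt => (mollifier N p.2 : ℂ) * perExt f (p.1 - p.2))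
      ((volume.restrict cellY).prod volume) := by
    refine AEStronglyMeasurable.mul ?_ ?_
    · exact (Complex.measurable_ofReal.comp
        ((measurable_mollifier N).comp measurable_snd)).aestronglyMeasurable
    · have h := (aestronglyMeasurable_perExt hf.1).comp_quasiMeasurePreserving
        -- Null sets pull back to null sets under subtraction for the full product measure;
        -- restriction to the cell only shrinks that measure.
        (quasiMeasurePreserving_sub (volume : Measure Pt) (volume : Measure Pt))
      refine h.mono_ac ?_
      exact Measure.AbsolutelyContinuous.prod Measure.absolutelyContinuous_restrict
        Measure.AbsolutelyContinuous.rfl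
  have hper (g : intLattice) (x : Pt) : ‖perExt f (g +ᵥ x)‖ = ‖perExt f x‖ := by
    rw [perExt_vadd]
  rw [integrable_prod_iff' hm]
  refine ⟨Eventually.of_forall fun y => ?_, ?_⟩
  · exact (integrableOn_cellY_sub _ (perExt_vadd f) (integrableOn_perExt hf) y).const_mul
      (mollifier N y : ℂ)
  · simp only [norm_mul, integral_const_mul]
    simp only [setIntegral_cellY_sub (fun x => ‖perExt f x‖) hper]
    exact (integrable_mollifier N).ofReal.norm.mul_const _

lemma integrableOn_mollify (N : ℕ) {f : Pt → ℂ} (hf : IntegrableOn f cellY) :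
    IntegrableOn (mollify N f) cellY :=
  (integrable_mollify_integrand N hf).integral_prod_left

/-- The convolution theorem: after Fubini, split `expo ξ x` as `expo ξ y * expo ξ (x - y)` and
translate the periodic integrand. -/
lemma setIntegral_mollify_mul_expo {N : ℕ} (hN : 0 < N) {f : Pt → ℂ} (hf : IntegrableOn f cellY)
    (ξ : Fin 3 → ℤ) :
    ∫ x in cellY, mollify N f x * expo ξ x =
      mollifierCoef N ξ * ∫ x in cellY, f x * expo ξ x := by
  have h1 (x : Pt) : mollify N f x * expo ξ x =
      ∫ y, (mollifier N y : ℂ) * perExt f (x - y) * expo ξ x := by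
    rw [mollify, integral_mul_const]
  have hi : Integrable
      (fun p : Pt × Pt => (mollifier N p.2 : ℂ) * perExt f (p.1 - p.2) * expo ξ p.1)
      ((volume.restrict cellY).prod volume) := by
    refine (integrable_mollify_integrand N hf).mul_bdd (c := 1)
      ((continuous_expo ξ).comp continuous_fst).aestronglyMeasurable ?_
    exact Eventually.of_forall fun p => (norm_expo ξ _).le
  have h2 (y : Pt) : ∫ x in cellY, (mollifier N y : ℂ) * perExt f (x - y) * expo ξ x =
      (mollifier N y * expo ξ y) * ∫ x in cellY, f x * expo ξ x := by
    have h3 (x : Pt) : (mollifier N y : ℂ) * perExt f (x - y) * expo ξ x =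
        (mollifier N y * expo ξ y) * (perExt f (x - y) * expo ξ (x - y)) := by
      have : expo ξ x = expo ξ y * expo ξ (x - y) := by rw [← expo_add_right]; simp
      rw [this]; ring
    simp only [h3, integral_const_mul]
    rw [setIntegral_cellY_sub (fun x => perExt f x * expo ξ x)
      (fun g x => by simp only [perExt_vadd, expo_vadd])]
    congr 1
    exact setIntegral_congr_fun measurableSet_cellY fun x hx => by
      simp only [perExt_eq_of_mem f hx]
  simp only [h1]
  rw [integral_integral_swap hi]
  simp only [h2, integral_mul_const]
  rw [integral_mollifier_mul_expo hN]

lemma integrableOn_opR (N : ℕ) {f : Pt → ℂ} (hf : IntegrableOn f cellY) :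
    IntegrableOn (opR N f) cellY :=
  integrableOn_mollify N (integrableOn_mollify N hf)

lemma setIntegral_opR_mul_expo {N : ℕ} (hN : 0 < N) {f : Pt → ℂ} (hf : IntegrableOn f cellY)
    (ξ : Fin 3 → ℤ) :
    ∫ x in cellY, opR N f x * expo ξ x =
      (mollifierCoef N ξ : ℂ) ^ 2 * ∫ x in cellY, f x * expo ξ x := by
  rw [opR, setIntegral_mollify_mul_expo hN (integrableOn_mollify N hf),
    setIntegral_mollify_mul_expo hN hf]
  ring

end PeriodicExtension

/-! ### The Moulinec–Suquet pairing as a sum over voxels -/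

lemma projP_eq_trigPoly (N : ℕ) (f : Pt → ℂ) : projP N f = trigPoly N (fourierCoef f) := rfl

/-- The phase in `opQ` moves the sampling points of the discrete Fourier transform from the corners
`I/N` to the voxel centres, matching `voxelAvg_expo`. -/
lemma opQ_eq_trigPoly (N : ℕ) (f : Pt → ℂ) : opQ N f = trigPoly N fun ξ =>
    ((mollifierCoef N ξ : ℂ))⁻¹ * (((N : ℂ) ^ 3)⁻¹ *
      ∑ I, voxelAvg N f I * expo (-ξ) (voxelCentre N I)) := by
  have key (ξ : Fin 3 → ℤ) : Complex.exp (-(Real.pi * Complex.I * ((∑ m, (ξ m : ℂ)) / N))) *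
      dft N (voxelAvg N f) ξ =
      ((N : ℂ) ^ 3)⁻¹ * ∑ I, voxelAvg N f I * expo (-ξ) (voxelCentre N I) := by
    rw [dft, mul_left_comm, Finset.mul_sum]
    congr 1
    refine Finset.sum_congr rfl fun I _ => ?_
    rw [mul_left_comm, ← Complex.exp_add, expo]
    congr 2
    simp only [Fin.sum_univ_three, voxelCentre, Pi.neg_apply]
    push_cast
    ring
  ext x
  simp only [opQ, trigPoly, ← key]
  exact Finset.sum_congr rfl fun ξ _ => by ring

lemma norm_trigPoly_le (N : ℕ) (c : (Fin 3 → ℤ) → ℂ) (x : Pt) :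
    ‖trigPoly N c x‖ ≤ ∑ ξ ∈ freqs N, ‖c ξ‖ := by
  refine (norm_sum_le _ _).trans (Finset.sum_le_sum fun ξ _ => ?_)
  rw [norm_mul, norm_expo, mul_one]

lemma integrableOn_mul_trigPoly {g : Pt → ℂ} (hg : IntegrableOn g cellY) (N : ℕ)
    (c : (Fin 3 → ℤ) → ℂ) : IntegrableOn (fun x => g x * trigPoly N c x) cellY :=
  hg.mul_bdd (c := ∑ ξ ∈ freqs N, ‖c ξ‖)
    (contDiff_trigPoly N c).continuous.aestronglyMeasurable
    (Eventually.of_forall (norm_trigPoly_le N c))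

lemma integrableOn_conj {h : Pt → ℂ} (hh : IntegrableOn h cellY) :
    IntegrableOn (fun x => (starRingEnd ℂ) (h x)) cellY :=
  Complex.conjCLE.toContinuousLinearMap.integrable_comp hh

lemma setIntegral_conj_mul_expo (h : Pt → ℂ) (ξ : Fin 3 → ℤ) :
    ∫ x in cellY, (starRingEnd ℂ) (h x) * expo ξ x = (starRingEnd ℂ) (fourierCoef h ξ) := by
  rw [fourierCoef, ← integral_conj]
  refine integral_congr_ae (Eventually.of_forall fun x => ?_)
  simp only [map_mul, conj_expo, neg_neg]

lemma integrableOn_opR_mul_opQ (N : ℕ) {h : Pt → ℂ} (hh : IntegrableOn h cellY) (f : Pt → ℂ) :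
    IntegrableOn (fun x => opR N (fun y => (starRingEnd ℂ) (h y)) x * opQ N f x) cellY := by
  rw [opQ_eq_trigPoly]
  exact integrableOn_mul_trigPoly (integrableOn_opR N (integrableOn_conj hh)) N _

/-- `opR` contributes two factors `mollifierCoef`, `opQ` cancels one, and the remaining one turns
the modes of `P_N h` into their voxel averages. -/
lemma setIntegral_opR_conj_mul_opQ {N : ℕ} (hN : 0 < N) {h : Pt → ℂ} (hh : IntegrableOn h cellY)
    (f : Pt → ℂ) :
    ∫ x in cellY, opR N (fun y => (starRingEnd ℂ) (h y)) x * opQ N f x =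
      ((N : ℂ) ^ 3)⁻¹ * ∑ I, (starRingEnd ℂ) (voxelAvg N (projP N h) I) * voxelAvg N f I := by
  have hR := integrableOn_opR N (integrableOn_conj hh)
  have hi (ξ : Fin 3 → ℤ) : IntegrableOn
      (fun x => opR N (fun y => (starRingEnd ℂ) (h y)) x * expo ξ x) cellY :=
    hR.mul_bdd (c := 1) (continuous_expo ξ).aestronglyMeasurable
      (Eventually.of_forall fun x => (norm_expo ξ x).le)
  rw [opQ_eq_trigPoly, projP_eq_trigPoly]
  simp only [trigPoly, Finset.mul_sum (s := freqs N), mul_left_comm (opR N _ _)]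
  rw [integral_finsetSum _ fun ξ _ => (hi ξ).const_mul _]
  simp only [integral_const_mul, setIntegral_opR_mul_expo hN (integrableOn_conj hh),
    setIntegral_conj_mul_expo]
  simp only [voxelAvg_trigPoly hN, map_sum, map_mul, Complex.conj_ofReal, conj_expo, Finset.sum_mul]
  rw [Finset.sum_comm, Finset.mul_sum]
  refine Finset.sum_congr rfl fun ξ hξ => ?_
  have hne : (mollifierCoef N ξ : ℂ) ≠ 0 := by exact_mod_cast (mollifierCoef_pos hN hξ).ne'
  simp only [Finset.mul_sum, Finset.sum_mul]
  refine Finset.sum_congr rfl fun I _ => ?_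
  field_simp

/-! ### Periodic Sobolev functions -/

lemma continuous_partialDeriv {𝕜 : Type} [RCLike 𝕜] {f : Pt → 𝕜} (hf : ContDiff ℝ ∞ f)
    (m : Fin 3) : Continuous (partialDeriv m f) := by
  have := hf.continuous_fderiv (by simp)
  unfold partialDeriv
  fun_prop

/-- The divergence theorem for the field `f` times the `m`-th unit vector: contributions of opposite
faces cancel by periodicity. -/
lemma setIntegral_partialDeriv_eq_zero {f : Pt → ℂ} (hf : ContDiff ℝ ∞ f) (hp : IsPeriodic f)
    (m : Fin 3) : ∫ x in cellY, partialDeriv m f x = 0 := by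
  have hae : (Set.Icc (0 : Pt) 1 : Set Pt) =ᵐ[volume] cellY := by
    rw [cellY]
    exact Measure.univ_pi_Ioo_ae_eq_Icc.symm
  have hd : Differentiable ℝ f := hf.differentiable (by simp)
  have hc := continuous_partialDeriv hf m
  rw [← setIntegral_congr_set hae]
  have key := integral_divergence_of_hasFDerivAt_off_countable' (0 : Pt) 1 zero_le_one
    (fun i => if i = m then f else 0) (fun i x => if i = m then fderiv ℝ f x else 0) ∅
    Set.countable_empty
    (fun i => by
      split_ifs
      · exact hf.continuous.continuousOn
      · exact continuousOn_const)
    (fun x _ i => by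
      split_ifs
      · exact (hd x).hasFDerivAt
      · exact hasFDerivAt_const _ _)
    (by
      have : (fun x : Pt => ∑ i, (if i = m then fderiv ℝ f x else 0) (Pi.single i 1)) =
          partialDeriv m f := by
        ext x
        rw [Finset.sum_eq_single m (fun i _ hi => by simp [hi]) (by simp)]
        simp [partialDeriv]
      rw [this]
      exact hc.continuousOn.integrableOn_compact isCompact_Icc)
  have h1 (x : Pt) : ∑ i, (if i = m then fderiv ℝ f x else 0) (Pi.single i 1) =
      partialDeriv m f x := by
    rw [Finset.sum_eq_single m (fun i _ hi => by simp [hi]) (by simp)]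
    simp [partialDeriv]
  simp only [h1] at key
  rw [key]
  refine Finset.sum_eq_zero fun i _ => ?_
  rw [sub_eq_zero]
  refine integral_congr_ae (Eventually.of_forall fun x => ?_)
  dsimp only
  split_ifs with hi
  · have := hp (i.insertNth ((0 : Pt) i) x) i
    rw [← this]
    congr 1
    ext j
    refine Fin.succAboveCases i ?_ (fun k => ?_) j
    · simp
    · simp [Fin.succAbove_ne]
  · rfl

/-- Integration by parts: the product of `f` and `expo (-ξ)` is periodic, so its derivative has mean
zero. -/
lemma fourierCoef_partialDeriv {f : Pt → ℂ} (hf : ContDiff ℝ ∞ f) (hp : IsPeriodic f)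
    (m : Fin 3) (ξ : Fin 3 → ℤ) :
    fourierCoef (partialDeriv m f) ξ = 2 * Real.pi * Complex.I * ξ m * fourierCoef f ξ := by
  have hd : Differentiable ℝ f := hf.differentiable (by simp)
  have hc := continuous_partialDeriv hf m
  have he : Differentiable ℝ (expo (-ξ)) := (contDiff_expo _).differentiable (by simp)
  have h0 := setIntegral_partialDeriv_eq_zero (hf.mul (contDiff_expo (-ξ)))
    (fun x j => by dsimp only; rw [hp x j, isPeriodic_expo (-ξ) x j]) m
  have h1 (x : Pt) : partialDeriv m (fun x => f x * expo (-ξ) x) x =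
      partialDeriv m f x * expo (-ξ) x -
        2 * Real.pi * Complex.I * ξ m * (f x * expo (-ξ) x) := by
    have h2 := partialDeriv_expo (-ξ) m x
    rw [partialDeriv] at h2 ⊢
    rw [fderiv_fun_mul (hd x) (he x)]
    simp only [add_apply, smul_apply, smul_eq_mul, h2, partialDeriv]
    simp
    ring
  simp only [h1] at h0
  have i1 : IntegrableOn (fun x => partialDeriv m f x * expo (-ξ) x) cellY :=
    integrableOn_of_continuous (hc.mul (continuous_expo _))
  have i2 : IntegrableOn (fun x => f x * expo (-ξ) x) cellY :=
    integrableOn_of_continuous (hf.continuous.mul (continuous_expo _))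
  rw [integral_sub i1 (i2.const_mul _), integral_const_mul] at h0
  exact sub_eq_zero.1 h0

/-- Fourier coefficients are continuous for the `L¹`-norm, which the `L²`-norm dominates on a
probability space. It carries `fourierCoef_partialDeriv` over to weak gradients. -/
lemma tendsto_fourierCoef {φ : ℕ → Pt → ℂ} {f : Pt → ℂ}
    (hφ : ∀ k, Continuous (φ k)) (hf : MemLp f 2 (volume.restrict cellY))
    (h : Tendsto (fun k => eLpNorm (fun x => φ k x - f x) 2 (volume.restrict cellY)) atTop (𝓝 0))
    (ξ : Fin 3 → ℤ) :
    Tendsto (fun k => fourierCoef (φ k) ξ) atTop (𝓝 (fourierCoef f ξ)) := by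
  have hfi : Integrable f (volume.restrict cellY) := hf.integrable (by norm_num)
  have hmul {g : Pt → ℂ} (hg : Integrable g (volume.restrict cellY)) :
      Integrable (fun x => g x * expo (-ξ) x) (volume.restrict cellY) :=
    hg.mul_bdd (c := 1) (continuous_expo _).aestronglyMeasurable
      (Eventually.of_forall fun x => (norm_expo _ x).le)
  refine tendsto_integral_of_L1' _ (hmul hfi).1
    (Eventually.of_forall fun k => hmul (integrableOn_of_continuous (hφ k))) ?_
  refine tendsto_of_tendsto_of_tendsto_of_le_of_le tendsto_const_nhds h (fun _ => zero_le)
    fun k => ?_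
  calc eLpNorm ((fun x => φ k x * expo (-ξ) x) - fun x => f x * expo (-ξ) x) 1
        (volume.restrict cellY)
      = eLpNorm (fun x => φ k x - f x) 1 (volume.restrict cellY) := by
        refine eLpNorm_congr_norm_ae (Eventually.of_forall fun x => ?_)
        simp only [Pi.sub_apply]
        rw [← sub_mul, norm_mul, norm_expo, mul_one]
    _ ≤ _ := eLpNorm_le_eLpNorm_of_exponent_le (by norm_num)
        ((hφ k).aestronglyMeasurable.sub hf.1)

lemma FFTHom.HasH1PerGrad.fourierCoef_grad {f : Pt → ℂ} {g : Fin 3 → Pt → ℂ} (h : HasH1PerGrad f g)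
    (m : Fin 3) (ξ : Fin 3 → ℤ) :
    fourierCoef (g m) ξ = 2 * Real.pi * Complex.I * ξ m * fourierCoef f ξ := by
  obtain ⟨hf, hg, φ, hφ, h1, h2⟩ := h
  have t1 := (tendsto_fourierCoef (fun k => (hφ k).1.continuous) hf h1 ξ).const_mul
    (2 * Real.pi * Complex.I * ξ m)
  have t2 := tendsto_fourierCoef (fun k => continuous_partialDeriv (hφ k).1 m) (hg m) (h2 m) ξ
  simp only [fun k => fourierCoef_partialDeriv (hφ k).1 (hφ k).2 m ξ] at t2
  exact tendsto_nhds_unique t2 t1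

lemma partialDeriv_clm_comp {𝕜 𝕜' : Type} [RCLike 𝕜] [RCLike 𝕜'] (L : 𝕜 →L[ℝ] 𝕜')
    {f : Pt → 𝕜} (hf : ContDiff ℝ ∞ f) (m : Fin 3) (x : Pt) :
    partialDeriv m (fun y => L (f y)) x = L (partialDeriv m f x) := by
  have hd : DifferentiableAt ℝ f x := hf.differentiable (by simp) x
  have := (L.hasFDerivAt.comp x hd.hasFDerivAt).fderiv
  rw [partialDeriv, partialDeriv]
  change fderiv ℝ (L ∘ f) x _ = _
  rw [this]
  rfl

lemma tendsto_eLpNorm_clm {𝕜 𝕜' : Type} [RCLike 𝕜] [RCLike 𝕜'] (L : 𝕜 →L[ℝ] 𝕜')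
    {φ : ℕ → Pt → 𝕜} {μ : Measure Pt}
    (h : Tendsto (fun k => eLpNorm (φ k) 2 μ) atTop (𝓝 0)) :
    Tendsto (fun k => eLpNorm (fun x => L (φ k x)) 2 μ) atTop (𝓝 0) := by
  have h' := ENNReal.Tendsto.const_mul (a := ENNReal.ofReal ‖L‖) h (Or.inr ENNReal.ofReal_ne_top)
  rw [mul_zero] at h'
  refine tendsto_of_tendsto_of_tendsto_of_le_of_le tendsto_const_nhds h' (fun _ => zero_le)
    fun k => ?_
  exact eLpNorm_le_mul_eLpNorm_of_ae_le_mul (Eventually.of_forall fun x => L.le_opNorm _) 2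

/-- Applied to the real part, the imaginary part and the embedding of the reals, this links the real
cell problem to the complex scheme. -/
lemma FFTHom.HasH1PerGrad.clm_comp {𝕜 𝕜' : Type} [RCLike 𝕜] [RCLike 𝕜'] (L : 𝕜 →L[ℝ] 𝕜')
    {f : Pt → 𝕜} {g : Fin 3 → Pt → 𝕜} (h : HasH1PerGrad f g) :
    HasH1PerGrad (fun x => L (f x)) (fun m x => L (g m x)) := by
  obtain ⟨hf, hg, φ, hφ, h1, h2⟩ := h
  refine ⟨L.comp_memLp' hf, fun m => L.comp_memLp' (hg m), fun k x => L (φ k x), fun k =>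
    ⟨L.contDiff.comp (hφ k).1, fun x m => by dsimp only; rw [(hφ k).2 x m]⟩, ?_, fun m => ?_⟩
  · simp only [← map_sub]
    exact tendsto_eLpNorm_clm L h1
  · simp only [partialDeriv_clm_comp L (hφ _).1, ← map_sub]
    exact tendsto_eLpNorm_clm L (h2 m)

lemma memLp_of_continuous {𝕜 : Type} [RCLike 𝕜] {f : Pt → 𝕜} (hf : Continuous f) :
    MemLp f 2 (volume.restrict cellY) := by
  rw [memLp_two_iff_integrable_sq_norm hf.aestronglyMeasurable]
  exact integrableOn_of_continuous (by fun_prop)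

lemma hasH1PerGrad_of_contDiff {𝕜 : Type} [RCLike 𝕜] {f : Pt → 𝕜} (hf : ContDiff ℝ ∞ f)
    (hp : IsPeriodic f) : HasH1PerGrad f (fun m => partialDeriv m f) :=
  ⟨memLp_of_continuous hf.continuous, fun m => memLp_of_continuous (continuous_partialDeriv hf m),
    fun _ => f, fun _ => ⟨hf, hp⟩, by simp, by simp⟩

/-! ### Bounds for the stiffness tensors -/

/-- The symmetry and coercivity conditions on a single stiffness tensor. -/
structure StiffnessBounds (A : Tensor4) (a b : ℝ) : Prop where
  lower_pos : 0 < a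
  upper_pos : 0 < b
  symm_left : ∀ m n p q, A m n p q = A n m p q
  symm_major : ∀ m n p q, A m n p q = A p q m n
  lower : ∀ F : Mat ℝ, F.IsSymm → a * ddot F F ≤ ddot F (contract A F)
  upper : ∀ F : Mat ℝ, F.IsSymm → ddot F (contract A F) ≤ b * ddot F F

lemma FFTHom.AssumptionB.stiffnessBounds {M : ℕ} {Λ : Fin (M + 1) → Tensor4} {a b : ℝ}
    (h : AssumptionB Λ a b) (l : Fin (M + 1)) : StiffnessBounds (Λ l) a b :=
  ⟨h.lower_pos, h.upper_pos, h.symm_left l, h.symm_major l, h.lower l, h.upper l⟩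

/-- Pure or mixed, every voxel carries one of the phase tensors. Stability needs nothing else about
`C_N`; its accuracy enters only as an error term. -/
lemma stiffnessBounds_voxel {M N : ℕ} {D : Fin (M + 1) → Set Pt} {Λ : Fin (M + 1) → Tensor4}
    {a b : ℝ} {Cstar : (Fin 3 → Fin N) → Tensor4} (hB : AssumptionB Λ a b)
    (hC : AssumptionC N D Λ Cstar) (I : Fin 3 → Fin N) : StiffnessBounds (Cstar I) a b := by
  by_cases h : ∃ l, voxel N I ⊆ D l
  · obtain ⟨l, hl⟩ := h
    rw [hC.pure I l hl]
    exact hB.stiffnessBounds l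
  · obtain ⟨l, -, hl⟩ := hC.mixed I h
    rw [hl]
    exact hB.stiffnessBounds l

lemma contract_sub_smul (A : Tensor4) (F G : Mat ℝ) (s : ℝ) :
    contract A (F - s • G) = contract A F - s • contract A G := by
  ext m n
  simp only [contract, Matrix.sub_apply, Matrix.smul_apply, smul_eq_mul, Finset.mul_sum,
    ← Finset.sum_sub_distrib]
  refine Finset.sum_congr rfl fun p _ => Finset.sum_congr rfl fun q _ => ?_
  ring

lemma ddot_self_nonneg (F : Mat ℝ) : 0 ≤ ddot F F :=
  Finset.sum_nonneg fun m _ => Finset.sum_nonneg fun n _ => mul_self_nonneg (F m n)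

namespace StiffnessBounds

variable {A : Tensor4} {a b : ℝ}

lemma contract_isSymm (h : StiffnessBounds A a b) (F : Mat ℝ) : (contract A F).IsSymm := by
  refine Matrix.IsSymm.ext fun m n => ?_
  simp only [contract]
  refine Finset.sum_congr rfl fun p _ => Finset.sum_congr rfl fun q _ => ?_
  rw [h.symm_left]

lemma ddot_contract_comm (h : StiffnessBounds A a b) (F G : Mat ℝ) :
    ddot F (contract A G) = ddot G (contract A F) := by
  have hswap (H : Fin 3 → Fin 3 → Fin 3 → Fin 3 → ℝ) :
      ∑ m, ∑ n, ∑ p, ∑ q, H m n p q = ∑ p, ∑ q, ∑ m, ∑ n, H m n p q := by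
    rw [Finset.sum_congr rfl fun m _ => Finset.sum_comm, Finset.sum_comm]
    refine Finset.sum_congr rfl fun p _ => ?_
    rw [Finset.sum_congr rfl fun m _ => Finset.sum_comm, Finset.sum_comm]
  simp only [ddot, contract, Finset.mul_sum]
  rw [hswap]
  refine Finset.sum_congr rfl fun p _ => Finset.sum_congr rfl fun q _ =>
    Finset.sum_congr rfl fun m _ => Finset.sum_congr rfl fun n _ => ?_
  rw [h.symm_major m n p q]
  ring

lemma le_upper (h : StiffnessBounds A a b) : a ≤ b := by
  have h1 := h.lower 1 Matrix.isSymm_one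
  have h2 := h.upper 1 Matrix.isSymm_one
  have h3 : ddot (1 : Mat ℝ) 1 = 3 := by
    simp [ddot, Matrix.one_apply]
  rw [h3] at h1 h2
  linarith

/-- An upper bound on the quadratic form bounds the operator norm, without diagonalisation: with `G
= A : F`, nonnegativity of the form at `F - b⁻¹ G`, major symmetry and the upper bound at `G` give
`G : G ≤ b F : G`. -/
lemma ddot_contract_self_le (h : StiffnessBounds A a b) {F : Mat ℝ} (hF : F.IsSymm) :
    ddot (contract A F) (contract A F) ≤ b ^ 2 * ddot F F := by
  set G := contract A F with hG
  have hb := h.upper_pos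
  have hsymm : (F - b⁻¹ • G).IsSymm := hF.sub ((h.contract_isSymm F).smul _)
  have hq : 0 ≤ ddot (F - b⁻¹ • G) (contract A (F - b⁻¹ • G)) :=
    (mul_nonneg h.lower_pos.le (ddot_self_nonneg _)).trans (h.lower _ hsymm)
  have hlin : contract A (F - b⁻¹ • G) = G - b⁻¹ • contract A G := by
    rw [contract_sub_smul]
  have hexp : ddot (F - b⁻¹ • G) (G - b⁻¹ • contract A G) =
      ddot F G - b⁻¹ * ddot F (contract A G) - b⁻¹ * ddot G G + b⁻¹ ^ 2 * ddot G (contract A G) := by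
    simp only [ddot, Matrix.sub_apply, Matrix.smul_apply, smul_eq_mul, Finset.mul_sum,
      ← Finset.sum_sub_distrib, ← Finset.sum_add_distrib]
    refine Finset.sum_congr rfl fun p _ => Finset.sum_congr rfl fun q _ => ?_
    ring
  rw [hlin, hexp, h.ddot_contract_comm F G, ← hG] at hq
  have hu := h.upper G (h.contract_isSymm F)
  have hu2 := h.upper F hF
  rw [← hG] at hu2
  have h3 : b⁻¹ ^ 2 * ddot G (contract A G) ≤ b⁻¹ * ddot G G := by
    calc b⁻¹ ^ 2 * ddot G (contract A G) ≤ b⁻¹ ^ 2 * (b * ddot G G) := by gcongr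
      _ = _ := by field_simp
  have h4 : b⁻¹ * ddot G G ≤ ddot F G := by linarith
  have h5 : ddot G G ≤ b * ddot F G := by
    rwa [inv_mul_le_iff₀ hb] at h4
  calc ddot G G ≤ b * ddot F G := h5
    _ ≤ b * (b * ddot F F) := by gcongr
    _ = _ := by ring

lemma contract_re (A : Tensor4) (F : Mat ℂ) (m n : Fin 3) :
    (contract A F m n).re = contract A (fun p q => (F p q).re : Mat ℝ) m n := by
  simp [contract]

lemma contract_im (A : Tensor4) (F : Mat ℂ) (m n : Fin 3) :
    (contract A F m n).im = contract A (fun p q => (F p q).im : Mat ℝ) m n := by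
  simp [contract]

lemma isSymm_re {F : Mat ℂ} (hF : F.IsSymm) : Matrix.IsSymm (fun p q => (F p q).re : Mat ℝ) :=
  Matrix.IsSymm.ext fun p q => by rw [hF.apply]

lemma isSymm_im {F : Mat ℂ} (hF : F.IsSymm) : Matrix.IsSymm (fun p q => (F p q).im : Mat ℝ) :=
  Matrix.IsSymm.ext fun p q => by rw [hF.apply]

lemma sum_norm_sq_eq (F : Mat ℂ) : ∑ m, ∑ n, ‖F m n‖ ^ 2 =
    ddot (fun p q => (F p q).re : Mat ℝ) (fun p q => (F p q).re : Mat ℝ) +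
      ddot (fun p q => (F p q).im : Mat ℝ) (fun p q => (F p q).im : Mat ℝ) := by
  simp only [ddot, ← Finset.sum_add_distrib, Complex.sq_norm, Complex.normSq_apply]

/-- The tensor is real, so the real part of the sesquilinear form splits into the forms at the real
and imaginary parts of `F`. -/
lemma lower_complex (h : StiffnessBounds A a b) {F : Mat ℂ} (hF : F.IsSymm) :
    a * ∑ m, ∑ n, ‖F m n‖ ^ 2 ≤ (∑ m, ∑ n, (starRingEnd ℂ) (F m n) * contract A F m n).re := by
  have h1 := h.lower _ (isSymm_re hF)
  have h2 := h.lower _ (isSymm_im hF)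
  have h3 : (∑ m, ∑ n, (starRingEnd ℂ) (F m n) * contract A F m n).re =
      ddot (fun p q => (F p q).re : Mat ℝ) (contract A (fun p q => (F p q).re : Mat ℝ)) +
      ddot (fun p q => (F p q).im : Mat ℝ) (contract A (fun p q => (F p q).im : Mat ℝ)) := by
    simp only [ddot, ← Finset.sum_add_distrib, Complex.re_sum, Complex.mul_re, Complex.conj_re,
      Complex.conj_im, contract_re, contract_im]
    refine Finset.sum_congr rfl fun p _ => Finset.sum_congr rfl fun q _ => ?_
    ring
  rw [h3, sum_norm_sq_eq]
  linarith

lemma upper_complex (h : StiffnessBounds A a b) {F : Mat ℂ} (hF : F.IsSymm) :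
    ∑ m, ∑ n, ‖contract A F m n‖ ^ 2 ≤ b ^ 2 * ∑ m, ∑ n, ‖F m n‖ ^ 2 := by
  have h1 := h.ddot_contract_self_le (isSymm_re hF)
  have h2 := h.ddot_contract_self_le (isSymm_im hF)
  rw [sum_norm_sq_eq, sum_norm_sq_eq]
  simp only [contract_re, contract_im]
  linarith

end StiffnessBounds

/-! ### Strains of trigonometric polynomials -/

/-- The Fourier coefficients of the strain of a vector field with Fourier coefficients `c`. -/
noncomputable def strainCoef (c : Fin 3 → (Fin 3 → ℤ) → ℂ) (m n : Fin 3) (ξ : Fin 3 → ℤ) : ℂ :=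
  (2 * Real.pi * Complex.I * ξ m * c n ξ + 2 * Real.pi * Complex.I * ξ n * c m ξ) / 2

lemma strainCoef_comm (c : Fin 3 → (Fin 3 → ℤ) → ℂ) (m n : Fin 3) :
    strainCoef c m n = strainCoef c n m := by
  ext ξ
  rw [strainCoef, strainCoef, add_comm]

lemma strainCoef_add (c d : Fin 3 → (Fin 3 → ℤ) → ℂ) (m n : Fin 3) (ξ : Fin 3 → ℤ) :
    strainCoef (c + d) m n ξ = strainCoef c m n ξ + strainCoef d m n ξ := by
  simp only [strainCoef, Pi.add_apply]
  ring

lemma strainCoef_sub (c d : Fin 3 → (Fin 3 → ℤ) → ℂ) (m n : Fin 3) (ξ : Fin 3 → ℤ) :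
    strainCoef (c - d) m n ξ = strainCoef c m n ξ - strainCoef d m n ξ := by
  simp only [strainCoef, Pi.sub_apply]
  ring

lemma strainCoef_smul (z : ℂ) (c : Fin 3 → (Fin 3 → ℤ) → ℂ) (m n : Fin 3) (ξ : Fin 3 → ℤ) :
    strainCoef (z • c) m n ξ = z * strainCoef c m n ξ := by
  simp only [strainCoef, Pi.smul_apply, smul_eq_mul]
  ring

/-- Korn's inequality on a single Fourier mode, in qualitative form. -/
lemma eq_zero_of_strainCoef_eq_zero {c : Fin 3 → (Fin 3 → ℤ) → ℂ} {ξ : Fin 3 → ℤ} (hξ : ξ ≠ 0)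
    (h : ∀ m n, strainCoef c m n ξ = 0) (n : Fin 3) : c n ξ = 0 := by
  obtain ⟨m, hm⟩ : ∃ m, ξ m ≠ 0 := by
    by_contra! hc
    exact hξ (funext hc)
  have hp : (Real.pi : ℂ) ≠ 0 := by exact_mod_cast Real.pi_ne_zero
  have hm' : (ξ m : ℂ) ≠ 0 := by exact_mod_cast hm
  -- The diagonal entry kills `c m`; the entry `(m, n)` then reduces to a nonzero multiple of `c n`.
  have h1 : c m ξ = 0 := by
    have := h m m
    simpa [strainCoef, hp, hm'] using this
  have := h m n
  simpa [strainCoef, hp, hm', h1] using this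

/-- The voxel averages of the strain of a trigonometric polynomial. -/
noncomputable def strainAvg (N : ℕ) (c : Fin 3 → (Fin 3 → ℤ) → ℂ) (I : Fin 3 → Fin N) : Mat ℂ :=
  fun m n => voxelAvg N (trigPoly N (strainCoef c m n)) I

lemma strainAvg_isSymm (N : ℕ) (c : Fin 3 → (Fin 3 → ℤ) → ℂ) (I : Fin 3 → Fin N) :
    (strainAvg N c I).IsSymm :=
  Matrix.IsSymm.ext fun m n => by simp only [strainAvg, strainCoef_comm c m n]

lemma strainAvg_eq {N : ℕ} (hN : 0 < N) (c : Fin 3 → (Fin 3 → ℤ) → ℂ) (I : Fin 3 → Fin N)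
    (m n : Fin 3) : strainAvg N c I m n = ∑ ξ ∈ freqs N, strainCoef c m n ξ *
      (mollifierCoef N ξ * expo ξ (voxelCentre N I)) :=
  voxelAvg_trigPoly hN _ I

lemma strainAvg_add {N : ℕ} (hN : 0 < N) (c d : Fin 3 → (Fin 3 → ℤ) → ℂ) :
    strainAvg N (c + d) = strainAvg N c + strainAvg N d := by
  ext I m n
  simp only [Pi.add_apply, Matrix.add_apply, strainAvg_eq hN, strainCoef_add, add_mul,
    Finset.sum_add_distrib]

lemma strainAvg_sub {N : ℕ} (hN : 0 < N) (c d : Fin 3 → (Fin 3 → ℤ) → ℂ) :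
    strainAvg N (c - d) = strainAvg N c - strainAvg N d := by
  ext I m n
  simp only [Pi.sub_apply, Matrix.sub_apply, strainAvg_eq hN, strainCoef_sub, sub_mul,
    Finset.sum_sub_distrib]

lemma strainAvg_smul {N : ℕ} (hN : 0 < N) (z : ℂ) (c : Fin 3 → (Fin 3 → ℤ) → ℂ) :
    strainAvg N (z • c) = z • strainAvg N c := by
  ext I m n
  simp only [Pi.smul_apply, Matrix.smul_apply, strainAvg_eq hN, strainCoef_smul, smul_eq_mul,
    Finset.mul_sum, mul_assoc]

lemma strainAvg_congr {N : ℕ} (hN : 0 < N) {c d : Fin 3 → (Fin 3 → ℤ) → ℂ}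
    (h : ∀ n, ∀ ξ ∈ freqs N, c n ξ = d n ξ) : strainAvg N c = strainAvg N d := by
  ext I m n
  rw [strainAvg_eq hN, strainAvg_eq hN]
  refine Finset.sum_congr rfl fun ξ hξ => ?_
  simp only [strainCoef, h _ ξ hξ]

/-- The discrete energy controls the `L²`-norm of the strain of a trigonometric polynomial. -/
lemma sum_norm_sq_strainCoef_le {N : ℕ} (hN : 0 < N) (c : Fin 3 → (Fin 3 → ℤ) → ℂ) :
    (2 / Real.pi) ^ 6 * ∑ m, ∑ n, ∑ ξ ∈ freqs N, ‖strainCoef c m n ξ‖ ^ 2 ≤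
      ((N : ℝ) ^ 3)⁻¹ * ∑ I, ∑ m, ∑ n, ‖strainAvg N c I m n‖ ^ 2 := by
  have key (m n : Fin 3) : ((N : ℝ) ^ 3)⁻¹ * ∑ I, ‖strainAvg N c I m n‖ ^ 2 =
      ∑ ξ ∈ freqs N, mollifierCoef N ξ ^ 2 * ‖strainCoef c m n ξ‖ ^ 2 := by
    have := sum_conj_voxelAvg_mul_voxelAvg hN (strainCoef c m n) (strainCoef c m n)
    simp only [Complex.conj_mul'] at this
    apply Complex.ofReal_injective
    push_cast
    exact this
  have h1 : ∑ I, ∑ m, ∑ n, ‖strainAvg N c I m n‖ ^ 2 =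
      ∑ m, ∑ n, ∑ I, ‖strainAvg N c I m n‖ ^ 2 := by
    rw [Finset.sum_comm]
    exact Finset.sum_congr rfl fun m _ => Finset.sum_comm
  rw [h1]
  simp only [Finset.mul_sum (s := (Finset.univ : Finset (Fin 3)))]
  refine Finset.sum_le_sum fun m _ => Finset.sum_le_sum fun n _ => ?_
  rw [key, Finset.mul_sum]
  refine Finset.sum_le_sum fun ξ hξ => ?_
  have := two_div_pi_pow_le_mollifierCoef hN hξ
  have hp := Real.pi_pos
  gcongr
  calc (2 / Real.pi) ^ 6 = ((2 / Real.pi) ^ 3) ^ 2 := by ring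
    _ ≤ _ := by gcongr

/-! ### Voxelwise constant stiffness -/

lemma eq_of_mem_voxel {N : ℕ} {I J : Fin 3 → Fin N} {x : Pt} (hI : x ∈ voxel N I)
    (hJ : x ∈ voxel N J) : I = J := by
  ext m
  have hN : (0 : ℝ) < N := by exact_mod_cast (I m).pos
  have h1 := hI m trivial
  have h2 := hJ m trivial
  have e1 : (I m : ℕ) < (J m : ℕ) + 1 := by
    have := (div_lt_div_iff_of_pos_right hN).1 (h1.1.trans h2.2)
    exact_mod_cast this
  have e2 : (J m : ℕ) < (I m : ℕ) + 1 := by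
    have := (div_lt_div_iff_of_pos_right hN).1 (h2.1.trans h1.2)
    exact_mod_cast this
  omega

lemma voxelField_eq_of_mem {N : ℕ} (Cstar : (Fin 3 → Fin N) → Tensor4) {I : Fin 3 → Fin N}
    {x : Pt} (hI : x ∈ voxel N I) : voxelField N Cstar x = Cstar I := by
  rw [voxelField, Finset.sum_eq_single I]
  · rw [Set.indicator_of_mem hI]
  · intro J _ hJ
    rw [Set.indicator_of_notMem fun h => hJ (eq_of_mem_voxel h hI)]
  · simp

lemma voxelAvg_congr {N : ℕ} {f g : Pt → ℂ} {I : Fin 3 → Fin N}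
    (h : ∀ x ∈ voxel N I, f x = g x) : voxelAvg N f I = voxelAvg N g I := by
  rw [voxelAvg_eq, voxelAvg_eq, setIntegral_congr_fun (measurableSet_voxel N I) h]

lemma voxelAvg_sub {N : ℕ} {f g : Pt → ℂ} (hf : IntegrableOn f cellY) (hg : IntegrableOn g cellY)
    (I : Fin 3 → Fin N) :
    voxelAvg N (fun x => f x - g x) I = voxelAvg N f I - voxelAvg N g I := by
  rw [voxelAvg_eq, voxelAvg_eq, voxelAvg_eq, integral_sub (hf.mono_set (voxel_subset_cellY I))
    (hg.mono_set (voxel_subset_cellY I)), mul_sub]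

lemma voxelAvg_const {N : ℕ} (hN : 0 < N) (z : ℂ) (I : Fin 3 → Fin N) :
    voxelAvg N (fun _ => z) I = z := by
  have hN' : (N : ℂ) ≠ 0 := by exact_mod_cast hN.ne'
  rw [voxelAvg_eq, setIntegral_const, volume_voxel, Complex.real_smul]
  push_cast
  field_simp

/-- The stiffness is constant on a voxel and leaves the average, so the scheme sees a strain only
through its voxel averages. -/
lemma voxelAvg_contract {N : ℕ} (Cstar : (Fin 3 → Fin N) → Tensor4) {F : Pt → Mat ℂ}
    (hF : ∀ p q, IntegrableOn (fun y => F y p q) cellY) (I : Fin 3 → Fin N) (m n : Fin 3) :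
    voxelAvg N (fun y => contract (voxelField N Cstar y) (F y) m n) I =
      contract (Cstar I) (fun p q => voxelAvg N (fun y => F y p q) I) m n := by
  have hi (p q : Fin 3) : IntegrableOn (fun y => F y p q) (voxel N I) :=
    (hF p q).mono_set (voxel_subset_cellY I)
  rw [voxelAvg_congr (g := fun y => ∑ p, ∑ q, (Cstar I m n p q : ℂ) * F y p q)
    fun x hx => by rw [voxelField_eq_of_mem Cstar hx]; rfl]
  simp only [voxelAvg_eq, contract]
  rw [integral_finsetSum _ fun p _ => integrable_finsetSum _ fun q _ => (hi p q).const_mul _,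
    Finset.mul_sum]
  refine Finset.sum_congr rfl fun p _ => ?_
  rw [integral_finsetSum _ fun q _ => (hi p q).const_mul _, Finset.mul_sum]
  refine Finset.sum_congr rfl fun q _ => ?_
  rw [integral_const_mul]
  simp only [RCLike.ofReal_eq_complex_ofReal]
  ring

/-! ### The discrete form of the Moulinec–Suquet problem -/

/-- The sum over the voxels of `∇ˢ v̄ : C_N : F`. -/
noncomputable def voxelForm (N : ℕ) (Cstar : (Fin 3 → Fin N) → Tensor4)
    (d : Fin 3 → (Fin 3 → ℤ) → ℂ) (F : (Fin 3 → Fin N) → Mat ℂ) : ℂ :=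
  ∑ I, ∑ m, ∑ n, (starRingEnd ℂ) (strainAvg N d I m n) * contract (Cstar I) (F I) m n

lemma contract_add (A : Tensor4) (F G : Mat ℂ) :
    contract A (F + G) = contract A F + contract A G := by
  ext m n
  simp only [contract, Matrix.add_apply, mul_add, Finset.sum_add_distrib]

lemma contract_sub (A : Tensor4) (F G : Mat ℂ) :
    contract A (F - G) = contract A F - contract A G := by
  ext m n
  simp only [contract, Matrix.sub_apply, mul_sub, Finset.sum_sub_distrib]

lemma contract_smul (A : Tensor4) (z : ℂ) (F : Mat ℂ) :
    contract A (z • F) = z • contract A F := by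
  ext m n
  simp only [contract, Matrix.smul_apply, smul_eq_mul, Finset.mul_sum, mul_left_comm]

lemma voxelForm_add (N : ℕ) (Cstar : (Fin 3 → Fin N) → Tensor4) (d : Fin 3 → (Fin 3 → ℤ) → ℂ)
    (F G : (Fin 3 → Fin N) → Mat ℂ) :
    voxelForm N Cstar d (F + G) = voxelForm N Cstar d F + voxelForm N Cstar d G := by
  simp only [voxelForm, Pi.add_apply, contract_add, Matrix.add_apply, mul_add,
    Finset.sum_add_distrib]

lemma voxelForm_sub (N : ℕ) (Cstar : (Fin 3 → Fin N) → Tensor4) (d : Fin 3 → (Fin 3 → ℤ) → ℂ)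
    (F G : (Fin 3 → Fin N) → Mat ℂ) :
    voxelForm N Cstar d (F - G) = voxelForm N Cstar d F - voxelForm N Cstar d G := by
  simp only [voxelForm, Pi.sub_apply, contract_sub, Matrix.sub_apply, mul_sub,
    Finset.sum_sub_distrib]

lemma le_re_voxelForm {N : ℕ} {Cstar : (Fin 3 → Fin N) → Tensor4} {a b : ℝ}
    (hC : ∀ I, StiffnessBounds (Cstar I) a b) (d : Fin 3 → (Fin 3 → ℤ) → ℂ) :
    a * ∑ I, ∑ m, ∑ n, ‖strainAvg N d I m n‖ ^ 2 ≤
      (voxelForm N Cstar d (strainAvg N d)).re := by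
  rw [voxelForm, Complex.re_sum, Finset.mul_sum]
  exact Finset.sum_le_sum fun I _ => (hC I).lower_complex (strainAvg_isSymm N d I)

/-- The mean-free coefficients of strain-free fields vanish. -/
lemma eq_zero_of_voxelForm_self_eq_zero {N : ℕ} (hN : 0 < N)
    {Cstar : (Fin 3 → Fin N) → Tensor4} {a b : ℝ}
    (hC : ∀ I, StiffnessBounds (Cstar I) a b) {d : Fin 3 → (Fin 3 → ℤ) → ℂ}
    (h : voxelForm N Cstar d (strainAvg N d) = 0) {ξ : Fin 3 → ℤ} (hξ : ξ ∈ freqs N)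
    (hξ0 : ξ ≠ 0) (n : Fin 3) : d n ξ = 0 := by
  have ha : 0 < a := (hC fun _ => ⟨0, hN⟩).lower_pos
  have h1 := le_re_voxelForm hC d
  rw [h, Complex.zero_re] at h1
  have h2 : ∑ I, ∑ m, ∑ n, ‖strainAvg N d I m n‖ ^ 2 ≤ 0 := by
    by_contra! hc
    nlinarith [mul_pos ha hc]
  have h3 := sum_norm_sq_strainCoef_le hN d
  have hp := Real.pi_pos
  have h4 : ∑ m, ∑ n, ∑ ξ ∈ freqs N, ‖strainCoef d m n ξ‖ ^ 2 ≤ 0 := by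
    by_contra! hc
    have e1 : (0 : ℝ) < (2 / Real.pi) ^ 6 := by positivity
    have e2 : ((N : ℝ) ^ 3)⁻¹ * ∑ I, ∑ m, ∑ n, ‖strainAvg N d I m n‖ ^ 2 ≤ 0 :=
      mul_nonpos_of_nonneg_of_nonpos (by positivity) h2
    linarith [mul_pos e1 hc]
  refine eq_zero_of_strainCoef_eq_zero hξ0 (fun m n => ?_) n
  have h5 : ‖strainCoef d m n ξ‖ ^ 2 ≤ ∑ m, ∑ n, ∑ ξ ∈ freqs N, ‖strainCoef d m n ξ‖ ^ 2 :=
    calc ‖strainCoef d m n ξ‖ ^ 2 ≤ ∑ ξ ∈ freqs N, ‖strainCoef d m n ξ‖ ^ 2 :=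
          Finset.single_le_sum (f := fun ξ => ‖strainCoef d m n ξ‖ ^ 2)
            (fun _ _ => by positivity) hξ
      _ ≤ ∑ n, ∑ ξ ∈ freqs N, ‖strainCoef d m n ξ‖ ^ 2 :=
          Finset.single_le_sum (f := fun n => ∑ ξ ∈ freqs N, ‖strainCoef d m n ξ‖ ^ 2)
            (fun _ _ => by positivity) (Finset.mem_univ n)
      _ ≤ _ := Finset.single_le_sum
            (f := fun m => ∑ n, ∑ ξ ∈ freqs N, ‖strainCoef d m n ξ‖ ^ 2)
            (fun _ _ => by positivity) (Finset.mem_univ m)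
  have h6 : ‖strainCoef d m n ξ‖ ^ 2 = 0 := le_antisymm (h5.trans h4) (by positivity)
  simpa using h6

lemma FFTHom.HasH1PerGradVec.fourierCoef_symPart {v : Pt → Fin 3 → ℂ} {Dv : Pt → Mat ℂ}
    (h : HasH1PerGradVec v Dv) (m n : Fin 3) :
    fourierCoef (fun y => symPart (Dv y) m n) =
      strainCoef (fun k => fourierCoef fun y => v y k) m n := by
  have hi (m n : Fin 3) (ξ : Fin 3 → ℤ) :
      Integrable (fun y => Dv y m n * expo (-ξ) y) (volume.restrict cellY) :=
    (((h n).2.1 m).integrable (by norm_num)).mul_bdd (c := 1)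
      (continuous_expo _).aestronglyMeasurable (Eventually.of_forall fun x => (norm_expo _ x).le)
  ext ξ
  have h1 := (h n).fourierCoef_grad m ξ
  have h2 := (h m).fourierCoef_grad n ξ
  rw [strainCoef, ← h1, ← h2]
  simp only [fourierCoef, symPart]
  rw [← integral_add (hi m n ξ) (hi n m ξ), ← integral_div]
  exact integral_congr_ae (Eventually.of_forall fun x => by ring)

lemma FFTHom.HasH1PerGradVec.memLp_symPart {𝕜 : Type} [RCLike 𝕜] {v : Pt → Fin 3 → 𝕜} {Dv : Pt → Mat 𝕜}
    (h : HasH1PerGradVec v Dv) (m n : Fin 3) :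
    MemLp (fun y => symPart (Dv y) m n) 2 (volume.restrict cellY) := by
  have := (((h n).2.1 m).add ((h m).2.1 n)).const_mul ((2 : 𝕜)⁻¹)
  refine this.ae_eq (Eventually.of_forall fun x => ?_)
  simp only [symPart, Pi.add_apply, div_eq_inv_mul]

lemma hasH1PerGradVec_trigPoly (N : ℕ) (c : Fin 3 → (Fin 3 → ℤ) → ℂ) :
    HasH1PerGradVec (fun x n => trigPoly N (c n) x) (gradVec fun x n => trigPoly N (c n) x) :=
  fun n => hasH1PerGrad_of_contDiff (contDiff_trigPoly N (c n)) (isPeriodic_trigPoly N (c n))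

lemma symPart_gradVec_trigPoly (N : ℕ) (c : Fin 3 → (Fin 3 → ℤ) → ℂ) (x : Pt) (m n : Fin 3) :
    symPart (gradVec (fun x n => trigPoly N (c n) x) x) m n = trigPoly N (strainCoef c m n) x := by
  have h (m n : Fin 3) : gradVec (fun x n => trigPoly N (c n) x) x m n =
      trigPoly N (fun ξ => 2 * Real.pi * Complex.I * ξ m * c n ξ) x := by
    rw [← partialDeriv_trigPoly]; rfl
  rw [symPart, h, h, trigPoly_add]
  simp only [trigPoly, strainCoef, Finset.sum_div]
  exact Finset.sum_congr rfl fun ξ _ => by ring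

lemma fourierCoef_trigPoly {N : ℕ} (c : (Fin 3 → ℤ) → ℂ) {ξ : Fin 3 → ℤ} (hξ : ξ ∈ freqs N) :
    fourierCoef (trigPoly N c) ξ = c ξ := by
  have h (x : Pt) : trigPoly N c x * expo (-ξ) x = ∑ η ∈ freqs N, c η * expo (η - ξ) x := by
    rw [trigPoly, Finset.sum_mul]
    refine Finset.sum_congr rfl fun η _ => ?_
    rw [sub_eq_add_neg, expo_add, mul_assoc]
  simp only [fourierCoef, h]
  rw [integral_finsetSum _ fun η _ =>
    (integrableOn_of_continuous (continuous_expo _)).const_mul _, Finset.sum_eq_single ξ]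
  · rw [integral_const_mul, setIntegral_expo_cellY, sub_self, if_pos rfl, mul_one]
  · intro η _ hne
    rw [integral_const_mul, setIntegral_expo_cellY, if_neg (sub_ne_zero.2 hne), mul_zero]
  · exact fun h => absurd hξ h

lemma setIntegral_ddot_opR_opQ {N : ℕ} (hN : 0 < N) {v : Pt → Fin 3 → ℂ} {Dv : Pt → Mat ℂ}
    (h : HasH1PerGradVec v Dv) (F : Pt → Mat ℂ) :
    ∫ x in cellY, ddot (entrywise (opR N) (fun y => conjMat (symPart (Dv y))) x)
        (entrywise (opQ N) F x) =
      ((N : ℂ) ^ 3)⁻¹ * ∑ I, ∑ m, ∑ n,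
        (starRingEnd ℂ) (strainAvg N (fun k => fourierCoef fun y => v y k) I m n) *
          voxelAvg N (fun y => F y m n) I := by
  have hi (m n : Fin 3) : IntegrableOn (fun y => symPart (Dv y) m n) cellY :=
    (h.memLp_symPart m n).integrable (by norm_num)
  simp only [ddot, entrywise, conjMat]
  rw [integral_finsetSum _ fun m _ => integrable_finsetSum _ fun n _ =>
    integrableOn_opR_mul_opQ N (hi m n) _, Finset.sum_comm, Finset.mul_sum]
  refine Finset.sum_congr rfl fun m _ => ?_
  rw [integral_finsetSum _ fun n _ => integrableOn_opR_mul_opQ N (hi m n) _, Finset.sum_comm,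
    Finset.mul_sum]
  refine Finset.sum_congr rfl fun n _ => ?_
  rw [setIntegral_opR_conj_mul_opQ hN (hi m n), projP_eq_trigPoly, h.fourierCoef_symPart]
  rfl

lemma setIntegral_ddot_opR_opQ_contract {N : ℕ} (hN : 0 < N) (Cstar : (Fin 3 → Fin N) → Tensor4)
    {v : Pt → Fin 3 → ℂ} {Dv : Pt → Mat ℂ} (h : HasH1PerGradVec v Dv) {F : Pt → Mat ℂ}
    (hF : ∀ p q, IntegrableOn (fun y => F y p q) cellY) :
    ∫ x in cellY, ddot (entrywise (opR N) (fun y => conjMat (symPart (Dv y))) x)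
        (entrywise (opQ N) (fun y => contract (voxelField N Cstar y) (F y)) x) =
      ((N : ℂ) ^ 3)⁻¹ * voxelForm N Cstar (fun k => fourierCoef fun y => v y k)
        (fun I p q => voxelAvg N (fun y => F y p q) I) := by
  rw [setIntegral_ddot_opR_opQ hN h]
  simp only [voxelAvg_contract Cstar hF, voxelForm]

/-- The Moulinec–Suquet problem in terms of Fourier coefficients and voxel averages. -/
lemma solvesMS_trigPoly_iff {N : ℕ} (hN : 0 < N) (Cstar : (Fin 3 → Fin N) → Tensor4) (E : Mat ℝ)
    (c : Fin 3 → (Fin 3 → ℤ) → ℂ) :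
    SolvesMS N Cstar E (fun x n => trigPoly N (c n) x) ↔ (∀ n, c n 0 = 0) ∧
      ∀ d, voxelForm N Cstar d (strainAvg N c + fun _ => toC E) = 0 := by
  have hN' : ((N : ℂ) ^ 3)⁻¹ ≠ 0 := by
    have : (N : ℂ) ≠ 0 := by exact_mod_cast hN.ne'
    positivity
  have hmean : MeanZero (fun x n => trigPoly N (c n) x) ↔ ∀ n, c n 0 = 0 :=
    forall_congr' fun n => by rw [setIntegral_trigPoly hN]
  have key (v : Pt → Fin 3 → ℂ) (Dv : Pt → Mat ℂ) (h : HasH1PerGradVec v Dv) :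
      (∫ x in cellY, ddot (entrywise (opR N) (fun y => conjMat (symPart (Dv y))) x)
        (entrywise (opQ N) (fun y => contract (voxelField N Cstar y)
          (symPart (gradVec (fun x n => trigPoly N (c n) x) y))) x) =
      -∫ x in cellY, ddot (entrywise (opR N) (fun y => conjMat (symPart (Dv y))) x)
        (entrywise (opQ N) (fun y => contract (voxelField N Cstar y) (toC E)) x)) ↔
      voxelForm N Cstar (fun k => fourierCoef fun y => v y k)
        (strainAvg N c + fun _ => toC E) = 0 := by
    rw [setIntegral_ddot_opR_opQ_contract hN Cstar h fun p q => ?_,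
      setIntegral_ddot_opR_opQ_contract hN Cstar h fun p q => ?_, voxelForm_add,
      eq_neg_iff_add_eq_zero, ← mul_add, mul_eq_zero, or_iff_right hN']
    · simp only [symPart_gradVec_trigPoly, voxelAvg_const hN]
      rfl
    · exact integrableOn_of_continuous continuous_const
    · simp only [symPart_gradVec_trigPoly]
      exact integrableOn_of_continuous (contDiff_trigPoly N _).continuous
  rw [SolvesMS, hmean]
  constructor
  · rintro ⟨-, h0, h⟩
    refine ⟨h0, fun d => ?_⟩
    -- Test with the trigonometric polynomial of coefficients `d`. Its Fourier coefficients need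
    -- agree with `d` only on `freqs N`, which is all that `strainAvg` reads.
    have hd := hasH1PerGradVec_trigPoly N d
    have := (key _ _ hd).1 (h _ _ hd)
    rw [voxelForm] at this ⊢
    rwa [strainAvg_congr hN (d := d) fun n ξ hξ => fourierCoef_trigPoly (d n) hξ] at this
  · rintro ⟨h0, h⟩
    exact ⟨fun n => ⟨c n, rfl⟩, h0, fun v Dv hv => (key v Dv hv).2 (h _)⟩

lemma FFTHom.SolvesMS.exists_trigPoly {N : ℕ} {Cstar : (Fin 3 → Fin N) → Tensor4} {E : Mat ℝ}
    {uN : Pt → Fin 3 → ℂ} (h : SolvesMS N Cstar E uN) :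
    ∃ c : Fin 3 → (Fin 3 → ℤ) → ℂ, uN = fun x n => trigPoly N (c n) x := by
  choose c hc using h.1
  exact ⟨c, funext fun x => funext fun n => congrFun (hc n) x⟩

/-! ### Existence and uniqueness -/

/-- A finite-dimensional Galerkin problem with a definite form is solvable. -/
lemma exists_galerkin_solution {V ι : Type*} [AddCommGroup V] [Module ℂ V]
    [FiniteDimensional ℂ V] [Fintype ι] (S T : V →ₗ[ℂ] ι → ℂ) (f : ι → ℂ)
    (h : ∀ v, ∑ i, (starRingEnd ℂ) (S v i) * T v i = 0 → v = 0) :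
    ∃ d, ∀ v, ∑ i, (starRingEnd ℂ) (S v i) * (T d i + f i) = 0 := by
  set b := Module.finBasis ℂ V
  -- The pairing is conjugate-linear in the test vector, so testing against a basis suffices.
  have hlin (g : ι → ℂ) (hg : ∀ j, ∑ i, (starRingEnd ℂ) (S (b j) i) * g i = 0) (v : V) :
      ∑ i, (starRingEnd ℂ) (S v i) * g i = 0 := by
    rw [← b.sum_repr v]
    simp only [map_sum, map_smul, Finset.sum_apply, Pi.smul_apply, smul_eq_mul, map_mul,
      Finset.sum_mul]
    rw [Finset.sum_comm]
    refine Finset.sum_eq_zero fun j _ => ?_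
    simp only [mul_assoc, ← Finset.mul_sum, hg j, mul_zero]
  -- The square Galerkin matrix: definiteness makes it injective, hence surjective.
  let L : V →ₗ[ℂ] Fin (Module.finrank ℂ V) → ℂ :=
    LinearMap.pi fun j => ∑ i, (starRingEnd ℂ) (S (b j) i) • (LinearMap.proj i).comp T
  have hL (v : V) (j) : L v j = ∑ i, (starRingEnd ℂ) (S (b j) i) * T v i := by
    simp [L]
  have hinj : Function.Injective L := by
    rw [← LinearMap.ker_eq_bot, LinearMap.ker_eq_bot']
    exact fun v hv => h v (hlin _ (fun j => by rw [← hL, hv]; rfl) v)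
  have hsurj : Function.Surjective L :=
    (LinearMap.injective_iff_surjective_of_finrank_eq_finrank (by simp)).1 hinj
  obtain ⟨d, hd⟩ := hsurj fun j => -∑ i, (starRingEnd ℂ) (S (b j) i) * f i
  refine ⟨d, hlin _ fun j => ?_⟩
  simp only [mul_add, Finset.sum_add_distrib]
  rw [← hL, hd, neg_add_cancel]

/-- Extension by zero of coefficients given on the nonzero frequencies. -/
noncomputable def extendCoef (N : ℕ) :
    (Fin 3 → (freqs N).erase 0 → ℂ) →ₗ[ℂ] (Fin 3 → (Fin 3 → ℤ) → ℂ) where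
  toFun v n ξ := if h : ξ ∈ (freqs N).erase 0 then v n ⟨ξ, h⟩ else 0
  map_add' v w := by
    ext n ξ
    simp only [Pi.add_apply]
    split_ifs <;> simp
  map_smul' z v := by
    ext n ξ
    simp only [Pi.smul_apply, RingHom.id_apply]
    split_ifs <;> simp

/-- Deleting the zero frequency removes the constants, the only kernel of the strain on `freqs N`,
and makes the form definite. -/
lemma exists_voxelForm_solution {N : ℕ} (hN : 0 < N) {Cstar : (Fin 3 → Fin N) → Tensor4} {a b : ℝ}
    (hC : ∀ I, StiffnessBounds (Cstar I) a b) (E : Mat ℝ) :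
    ∃ c : Fin 3 → (Fin 3 → ℤ) → ℂ, (∀ n, c n 0 = 0) ∧
      ∀ d, voxelForm N Cstar d (strainAvg N c + fun _ => toC E) = 0 := by
  let S : (Fin 3 → (freqs N).erase 0 → ℂ) →ₗ[ℂ] (Fin 3 → Fin N) × Fin 3 × Fin 3 → ℂ :=
    { toFun := fun v i => strainAvg N (extendCoef N v) i.1 i.2.1 i.2.2
      map_add' := fun v w => by
        ext i
        simp only [map_add, strainAvg_add hN, Pi.add_apply, Matrix.add_apply]
      map_smul' := fun z v => by
        ext i
        simp only [map_smul, strainAvg_smul hN, Pi.smul_apply, Matrix.smul_apply,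
          RingHom.id_apply] }
  let T : (Fin 3 → (freqs N).erase 0 → ℂ) →ₗ[ℂ] (Fin 3 → Fin N) × Fin 3 × Fin 3 → ℂ :=
    { toFun := fun v i => contract (Cstar i.1) (strainAvg N (extendCoef N v) i.1) i.2.1 i.2.2
      map_add' := fun v w => by
        ext i
        simp only [map_add, strainAvg_add hN, Pi.add_apply, contract_add, Matrix.add_apply]
      map_smul' := fun z v => by
        ext i
        simp only [map_smul, strainAvg_smul hN, Pi.smul_apply, contract_smul, Matrix.smul_apply,
          RingHom.id_apply] }
  obtain ⟨v, hv⟩ := exists_galerkin_solution S T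
    (fun i => contract (Cstar i.1) (toC E) i.2.1 i.2.2) (fun v hv => by
      have hv' : voxelForm N Cstar (extendCoef N v) (strainAvg N (extendCoef N v)) = 0 := by
        rw [← hv, voxelForm]
        simp only [Fintype.sum_prod_type]
        rfl
      ext n ξ
      have hξ := Finset.mem_erase.1 ξ.2
      have := eq_zero_of_voxelForm_self_eq_zero hN hC hv' hξ.2 hξ.1 n
      simpa [extendCoef, hξ.1, hξ.2] using this)
  refine ⟨extendCoef N v, fun n => by simp [extendCoef], fun d => ?_⟩
  have h1 := hv fun n ξ => d n ξ
  -- An arbitrary test `d` may have a zero mode, but that mode carries no strain.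
  have h2 : strainAvg N (extendCoef N fun n (ξ : (freqs N).erase 0) => d n ξ) = strainAvg N d := by
    ext I m n
    rw [strainAvg_eq hN, strainAvg_eq hN]
    refine Finset.sum_congr rfl fun ξ hξ => ?_
    congr 1
    by_cases h0 : ξ = 0
    · simp [strainCoef, h0]
    · simp [strainCoef, extendCoef, h0, hξ]
  rw [voxelForm, ← h1]
  simp only [Fintype.sum_prod_type, Pi.add_apply, contract_add, Matrix.add_apply]
  rw [← h2]
  rfl

theorem existsUnique_solvesMS {N : ℕ} (hN : 0 < N) {Cstar : (Fin 3 → Fin N) → Tensor4} {a b : ℝ}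
    (hC : ∀ I, StiffnessBounds (Cstar I) a b) (E : Mat ℝ) :
    ∃! uN : Pt → Fin 3 → ℂ, SolvesMS N Cstar E uN := by
  obtain ⟨c, hc⟩ := exists_voxelForm_solution hN hC E
  refine ⟨_, (solvesMS_trigPoly_iff hN Cstar E c).2 hc, fun u hu => ?_⟩
  obtain ⟨c', rfl⟩ := hu.exists_trigPoly
  obtain ⟨h0, h⟩ := (solvesMS_trigPoly_iff hN Cstar E c').1 hu
  -- The load `E` cancels in the difference of two solutions, which is then tested with itself.
  have hd : voxelForm N Cstar (c' - c) (strainAvg N (c' - c)) = 0 := by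
    rw [strainAvg_sub hN, ← add_sub_add_right_eq_sub (strainAvg N c') (strainAvg N c)
      (fun _ => toC E), voxelForm_sub, h, hc.2, sub_self]
  ext x n
  refine Finset.sum_congr rfl fun ξ hξ => ?_
  congr 1
  by_cases hξ0 : ξ = 0
  · rw [hξ0, h0, hc.1]
  · exact sub_eq_zero.1 (eq_zero_of_voxelForm_self_eq_zero hN hC hd hξ hξ0 n)

/-! ### Square-integrability of the strain and stress fields -/

lemma memLp_contract {𝕜 : Type} [RCLike 𝕜] {μ : Measure Pt} {A : Pt → Tensor4} {F : Pt → Mat 𝕜}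
    (hA : ∀ m n p q, MemLp (fun x => A x m n p q) ⊤ μ)
    (hF : ∀ p q, MemLp (fun x => F x p q) 2 μ) (m n : Fin 3) :
    MemLp (fun x => contract (A x) (F x) m n) 2 μ := by
  refine memLp_finsetSum _ fun p _ => memLp_finsetSum _ fun q _ => ?_
  exact (hF p q).mul (MemLp.ofReal (K := 𝕜) (hA m n p q))

/-- Measurability of `C` has to be derived: almost everywhere, `C` agrees with a finite sum of
indicators of open sets. -/
lemma FFTHom.AssumptionA.memLp_top {M : ℕ} {D : Fin (M + 1) → Set Pt} {Λ : Fin (M + 1) → Tensor4}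
    {C : Pt → Tensor4} (h : AssumptionA D Λ C) (m n p q : Fin 3) :
    MemLp (fun x => C x m n p q) ⊤ (volume.restrict cellY) := by
  have h1 : MemLp (fun x => ∑ l, (D l).indicator (fun _ => Λ l m n p q) x) ⊤
      (volume.restrict cellY) :=
    memLp_finsetSum _ fun l _ => (memLp_const _).indicator (h.isOpen l).measurableSet
  refine h1.ae_eq ?_
  have h2 : ∀ᵐ x ∂volume.restrict cellY, x ∈ ⋃ l, D l := by
    rw [ae_iff, Measure.restrict_apply' measurableSet_cellY]
    convert h.cover using 2
    ext x
    simp only [Set.mem_inter_iff, Set.mem_sdiff, Set.mem_ofPred_eq]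
    tauto
  filter_upwards [h2] with x hx
  obtain ⟨l, hl⟩ := Set.mem_iUnion.1 hx
  rw [Finset.sum_eq_single l]
  · rw [Set.indicator_of_mem hl, h.const l x hl]
  · intro l' _ hne
    exact Set.indicator_of_notMem (fun hl' => (h.disjoint l' l hne).notMem_of_mem_left hl' hl) _
  · simp

lemma memLp_top_voxelField (N : ℕ) (Cstar : (Fin 3 → Fin N) → Tensor4) (m n p q : Fin 3) :
    MemLp (fun x => voxelField N Cstar x m n p q) ⊤ (volume.restrict cellY) := by
  have h1 : MemLp (fun x => ∑ I, (voxel N I).indicator (fun _ => Cstar I m n p q) x) ⊤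
      (volume.restrict cellY) :=
    memLp_finsetSum _ fun I _ => (memLp_const _).indicator (measurableSet_voxel N I)
  convert! h1 using 2 with x
  simp only [voxelField, Finset.sum_apply]
  refine Finset.sum_congr rfl fun I _ => ?_
  by_cases hx : x ∈ voxel N I
  · simp only [Set.indicator_of_mem hx]
  · simp only [Set.indicator_of_notMem hx, Pi.zero_apply]

lemma FFTHom.HasH1PerGradVec.clm_comp {𝕜 𝕜' : Type} [RCLike 𝕜] [RCLike 𝕜'] (L : 𝕜 →L[ℝ] 𝕜')
    {v : Pt → Fin 3 → 𝕜} {Dv : Pt → Mat 𝕜} (h : HasH1PerGradVec v Dv) :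
    HasH1PerGradVec (fun x n => L (v x n)) (fun x m n => L (Dv x m n)) :=
  fun n => (h n).clm_comp L

lemma contract_toC (A : Tensor4) (F : Mat ℝ) (m n : Fin 3) :
    contract A (toC F) m n = ((contract A F m n : ℝ) : ℂ) := by
  simp [contract, toC]

/-! ### The `L²`-norm of matrix fields and Jensen's inequality on voxels -/

lemma l2Norm_nonneg (F : Pt → Mat ℂ) : 0 ≤ l2Norm F := Real.sqrt_nonneg _

lemma l2Norm_sq (F : Pt → Mat ℂ) : l2Norm F ^ 2 = ∫ x in cellY, ∑ m, ∑ n, ‖F x m n‖ ^ 2 :=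
  Real.sq_sqrt (integral_nonneg fun x => by positivity)

lemma integrable_sum_norm_sq {F : Pt → Mat ℂ}
    (hF : ∀ m n, MemLp (fun x => F x m n) 2 (volume.restrict cellY)) :
    IntegrableOn (fun x => ∑ m, ∑ n, ‖F x m n‖ ^ 2) cellY :=
  integrable_finsetSum _ fun m _ => integrable_finsetSum _ fun n _ =>
    (memLp_two_iff_integrable_sq_norm (hF m n).1).1 (hF m n)

lemma l2Norm_sq_eq_sum {F : Pt → Mat ℂ}
    (hF : ∀ m n, MemLp (fun x => F x m n) 2 (volume.restrict cellY)) :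
    l2Norm F ^ 2 = ∑ m, ∑ n, ∫ x in cellY, ‖F x m n‖ ^ 2 := by
  have h (m n : Fin 3) := (memLp_two_iff_integrable_sq_norm (hF m n).1).1 (hF m n)
  rw [l2Norm_sq, integral_finsetSum _ fun m _ => integrable_finsetSum _ fun n _ => h m n]
  exact Finset.sum_congr rfl fun m _ => integral_finsetSum _ fun n _ => h m n

lemma l2Norm_sub_sq_le {F G : Pt → Mat ℂ}
    (hF : ∀ m n, MemLp (fun x => F x m n) 2 (volume.restrict cellY))
    (hG : ∀ m n, MemLp (fun x => G x m n) 2 (volume.restrict cellY)) :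
    l2Norm (fun x => F x - G x) ^ 2 ≤ 2 * l2Norm F ^ 2 + 2 * l2Norm G ^ 2 := by
  simp only [l2Norm_sq]
  rw [← integral_const_mul, ← integral_const_mul, ← integral_add
    ((integrable_sum_norm_sq hF).const_mul _) ((integrable_sum_norm_sq hG).const_mul _)]
  refine integral_mono_of_nonneg (Eventually.of_forall fun x => by positivity)
    (((integrable_sum_norm_sq hF).const_mul _).add ((integrable_sum_norm_sq hG).const_mul _))
    (Eventually.of_forall fun x => ?_)
  simp only [Finset.mul_sum, ← Finset.sum_add_distrib, Matrix.sub_apply]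
  refine Finset.sum_le_sum fun m _ => Finset.sum_le_sum fun n _ => ?_
  have := norm_sub_le (F x m n) (G x m n)
  nlinarith [sq_nonneg (‖F x m n‖ - ‖G x m n‖), norm_nonneg (F x m n - G x m n)]

lemma norm_sq_voxelAvg_le {N : ℕ} {f : Pt → ℂ} (hf : MemLp f 2 (volume.restrict cellY))
    (I : Fin 3 → Fin N) :
    ((N : ℝ) ^ 3)⁻¹ * ‖voxelAvg N f I‖ ^ 2 ≤ ∫ x in voxel N I, ‖f x‖ ^ 2 := by
  have hN : (0 : ℝ) < N := by exact_mod_cast (I 0).pos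
  have h1 : IntegrableOn (fun x => ‖f x‖) (voxel N I) :=
    IntegrableOn.mono_set (hf.integrable (by norm_num)).norm (voxel_subset_cellY I)
  have h2 : IntegrableOn (fun x => ‖f x‖ ^ 2) (voxel N I) :=
    IntegrableOn.mono_set ((memLp_two_iff_integrable_sq_norm hf.1).1 hf) (voxel_subset_cellY I)
  have hc (t : ℝ) : IntegrableOn (fun _ : Pt => t) (voxel N I) :=
    (integrableOn_of_continuous continuous_const).mono_set (voxel_subset_cellY I)
  set t := ‖voxelAvg N f I‖ with ht
  have h3 : t ≤ (N : ℝ) ^ 3 * ∫ x in voxel N I, ‖f x‖ := by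
    rw [ht, voxelAvg_eq, norm_mul]
    simp only [norm_pow, Complex.norm_natCast]
    gcongr
    exact norm_integral_le_integral_norm _
  -- Jensen through the tangent line of the square at `t`, the modulus of the average.
  have h4 : ∫ x in voxel N I, (2 * t * ‖f x‖ - t ^ 2) ≤ ∫ x in voxel N I, ‖f x‖ ^ 2 :=
    integral_mono ((h1.const_mul _).sub (hc _)) h2 fun x => by
      dsimp only
      nlinarith [sq_nonneg (‖f x‖ - t)]
  rw [integral_sub (h1.const_mul _) (hc _), integral_const_mul, setIntegral_const, volume_voxel,
    smul_eq_mul] at h4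
  refine le_trans ?_ h4
  have h5 : ((N : ℝ) ^ 3)⁻¹ * t ≤ ∫ x in voxel N I, ‖f x‖ := by
    rwa [inv_mul_le_iff₀ (by positivity)]
  nlinarith [mul_le_mul_of_nonneg_left h5 (norm_nonneg (voxelAvg N f I))]

/-- Jensen's inequality for voxel averages. -/
lemma sum_norm_sq_voxelAvg_le {N : ℕ} {f : Pt → ℂ} (hf : MemLp f 2 (volume.restrict cellY)) :
    ((N : ℝ) ^ 3)⁻¹ * ∑ I, ‖voxelAvg N f I‖ ^ 2 ≤ ∫ x in cellY, ‖f x‖ ^ 2 := by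
  have h2 : IntegrableOn (fun x => ‖f x‖ ^ 2) cellY :=
    (memLp_two_iff_integrable_sq_norm hf.1).1 hf
  calc ((N : ℝ) ^ 3)⁻¹ * ∑ I, ‖voxelAvg N f I‖ ^ 2
      ≤ ∑ I : Fin 3 → Fin N, ∫ x in voxel N I, ‖f x‖ ^ 2 := by
        rw [Finset.mul_sum]
        exact Finset.sum_le_sum fun I _ => norm_sq_voxelAvg_le hf I
    _ = ∫ x in ⋃ I : Fin 3 → Fin N, voxel N I, ‖f x‖ ^ 2 := by
        rw [integral_iUnion_fintype (fun I => measurableSet_voxel N I) _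
          fun I => h2.mono_set (voxel_subset_cellY I)]
        exact fun I J hIJ => Set.disjoint_left.2 fun x hI hJ => hIJ (eq_of_mem_voxel hI hJ)
    _ ≤ _ := setIntegral_mono_set h2 (Eventually.of_forall fun x => by positivity)
        (Set.iUnion_subset fun I => voxel_subset_cellY I).eventuallyLE

lemma sum_norm_sq_voxelAvg_le_l2Norm {N : ℕ} {F : Pt → Mat ℂ}
    (hF : ∀ m n, MemLp (fun x => F x m n) 2 (volume.restrict cellY)) :
    ((N : ℝ) ^ 3)⁻¹ * ∑ I, ∑ m, ∑ n, ‖voxelAvg N (fun x => F x m n) I‖ ^ 2 ≤ l2Norm F ^ 2 := by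
  rw [l2Norm_sq_eq_sum hF, Finset.sum_comm, Finset.mul_sum]
  refine Finset.sum_le_sum fun m _ => ?_
  rw [Finset.sum_comm, Finset.mul_sum]
  exact Finset.sum_le_sum fun n _ => sum_norm_sq_voxelAvg_le (hF m n)

/-! ### The cell problem -/

section CellProblem

variable {M : ℕ} {D : Fin (M + 1) → Set Pt} {Λ : Fin (M + 1) → Tensor4} {C : Pt → Tensor4}
  {E : Mat ℝ} {u : Pt → Fin 3 → ℝ} {Du : Pt → Mat ℝ}

lemma FFTHom.HasH1PerGradVec.memLp_strain (hu : HasH1PerGradVec u Du) (E : Mat ℝ) (m n : Fin 3) :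
    MemLp (fun x => strain E Du x m n) 2 (volume.restrict cellY) := by
  have := ((hu.memLp_symPart m n).add (memLp_const (E m n))).ofReal (K := ℂ)
  exact this

lemma FFTHom.AssumptionA.memLp_stress (hA : AssumptionA D Λ C) (hu : HasH1PerGradVec u Du)
    (E : Mat ℝ) (m n : Fin 3) :
    MemLp (fun x => stress C E Du x m n) 2 (volume.restrict cellY) :=
  memLp_contract hA.memLp_top (hu.memLp_strain E) m n

lemma FFTHom.SolvesCellProblem.setIntegral_eq_zero (hA : AssumptionA D Λ C)
    (hu : SolvesCellProblem C E u Du) {v : Pt → Fin 3 → ℝ} {Dv : Pt → Mat ℝ}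
    (hv : HasH1PerGradVec v Dv) :
    ∫ x in cellY, ddot (symPart (Dv x)) (contract (C x) (symPart (Du x) + E)) = 0 := by
  have h := hu.2.2 v Dv hv
  have i1 : IntegrableOn (fun x => ddot (symPart (Dv x)) (contract (C x) (symPart (Du x)))) cellY :=
    integrable_finsetSum _ fun m _ => integrable_finsetSum _ fun n _ =>
      (hv.memLp_symPart m n).integrable_mul
        (memLp_contract hA.memLp_top hu.1.memLp_symPart m n)
  have i2 : IntegrableOn (fun x => ddot (symPart (Dv x)) (contract (C x) E)) cellY :=
    integrable_finsetSum _ fun m _ => integrable_finsetSum _ fun n _ =>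
      (hv.memLp_symPart m n).integrable_mul
        (memLp_contract (F := fun _ => E) hA.memLp_top (fun p q => memLp_const _) m n)
  rw [eq_neg_iff_add_eq_zero, ← integral_add i1 i2] at h
  rw [← h]
  refine integral_congr_ae (Eventually.of_forall fun x => ?_)
  simp only [ddot, contract, Matrix.add_apply, mul_add, Finset.sum_add_distrib]

/-- The stress is real and `ddot` does not conjugate, so the real and imaginary parts of `v` can be
used as separate real test fields. -/
lemma FFTHom.SolvesCellProblem.setIntegral_complex_eq_zero (hA : AssumptionA D Λ C)
    (hu : SolvesCellProblem C E u Du) {v : Pt → Fin 3 → ℂ} {Dv : Pt → Mat ℂ}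
    (hv : HasH1PerGradVec v Dv) :
    ∫ x in cellY, ddot (symPart (Dv x)) (stress C E Du x) = 0 := by
  have hi : IntegrableOn (fun x => ddot (symPart (Dv x)) (stress C E Du x)) cellY :=
    integrable_finsetSum _ fun m _ => integrable_finsetSum _ fun n _ =>
      (hv.memLp_symPart m n).integrable_mul (hA.memLp_stress hu.1 E m n)
  have hσ (x : Pt) (m n : Fin 3) : stress C E Du x m n =
      ((contract (C x) (symPart (Du x) + E) m n : ℝ) : ℂ) := contract_toC _ _ m n
  apply Complex.ext
  · rw [Complex.zero_re, ← hu.setIntegral_eq_zero hA (hv.clm_comp Complex.reCLM)]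
    refine (Complex.reCLM.integral_comp_comm hi).symm.trans
      (integral_congr_ae (Eventually.of_forall fun x => ?_))
    simp [ddot, symPart, hσ]
  · rw [Complex.zero_im, ← hu.setIntegral_eq_zero hA (hv.clm_comp Complex.imCLM)]
    refine (Complex.imCLM.integral_comp_comm hi).symm.trans
      (integral_congr_ae (Eventually.of_forall fun x => ?_))
    simp [ddot, symPart, hσ]

/-- The stress is divergence-free, mode by mode. -/
lemma FFTHom.SolvesCellProblem.sum_conj_strainCoef_mul_fourierCoef (hA : AssumptionA D Λ C)
    (hu : SolvesCellProblem C E u Du) (d : Fin 3 → (Fin 3 → ℤ) → ℂ) (ξ : Fin 3 → ℤ) :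
    ∑ m, ∑ n, (starRingEnd ℂ) (strainCoef d m n ξ) *
      fourierCoef (fun x => stress C E Du x m n) ξ = 0 := by
  have hs (n : Fin 3) : ContDiff ℝ ∞ fun x => (starRingEnd ℂ) (d n ξ) * expo (-ξ) x :=
    contDiff_const.mul (contDiff_expo _)
  -- The conjugate of the single mode `d · expo ξ`: its strain is the conjugate strain coefficient
  -- times `expo (-ξ)`, which extracts the coefficient of the stress at `ξ`.
  have hv : HasH1PerGradVec (fun x n => (starRingEnd ℂ) (d n ξ) * expo (-ξ) x)
      (gradVec fun x n => (starRingEnd ℂ) (d n ξ) * expo (-ξ) x) := fun n =>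
    hasH1PerGrad_of_contDiff (hs n) fun x m => by dsimp only; rw [isPeriodic_expo]
  have hg (x : Pt) (m n : Fin 3) :
      gradVec (fun x n => (starRingEnd ℂ) (d n ξ) * expo (-ξ) x) x m n =
        (starRingEnd ℂ) (2 * Real.pi * Complex.I * ξ m * d n ξ) * expo (-ξ) x := by
    have h1 := partialDeriv_expo (-ξ) m x
    have h2 : DifferentiableAt ℝ (expo (-ξ)) x := (contDiff_expo _).differentiable (by simp) x
    rw [partialDeriv] at h1
    rw [gradVec, partialDeriv, fderiv_const_mul h2, smul_apply, h1]
    simp [Complex.conj_ofNat]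
    ring
  have hsym (x : Pt) (m n : Fin 3) :
      symPart (gradVec (fun x n => (starRingEnd ℂ) (d n ξ) * expo (-ξ) x) x) m n =
        (starRingEnd ℂ) (strainCoef d m n ξ) * expo (-ξ) x := by
    rw [symPart, hg, hg, strainCoef, map_div₀, map_add, Complex.conj_ofNat]
    ring
  have h := hu.setIntegral_complex_eq_zero hA hv
  have hi (m n : Fin 3) : IntegrableOn (fun x => stress C E Du x m n * expo (-ξ) x) cellY :=
    ((hA.memLp_stress hu.1 E m n).integrable (by norm_num)).mul_bdd (c := 1)
      (continuous_expo _).aestronglyMeasurable (Eventually.of_forall fun x => (norm_expo _ x).le)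
  simp only [ddot, hsym, mul_assoc, mul_comm (expo (-ξ) _)] at h
  rw [integral_finsetSum _ fun m _ => integrable_finsetSum _ fun n _ => (hi m n).const_mul _] at h
  rw [← h]
  refine Finset.sum_congr rfl fun m _ => ?_
  rw [integral_finsetSum _ fun n _ => (hi m n).const_mul _]
  refine Finset.sum_congr rfl fun n _ => ?_
  rw [integral_const_mul, fourierCoef]

/-- Discrete Parseval diagonalises the pairing into modes weighted by `mollifierCoef N ξ ^ 2`, and
each mode vanishes. Truncating the stress excludes aliasing from higher frequencies. -/
lemma FFTHom.SolvesCellProblem.sum_conj_strainAvg_mul_voxelAvg_projP {N : ℕ} (hN : 0 < N)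
    (hA : AssumptionA D Λ C) (hu : SolvesCellProblem C E u Du) (d : Fin 3 → (Fin 3 → ℤ) → ℂ) :
    ∑ I, ∑ m, ∑ n, (starRingEnd ℂ) (strainAvg N d I m n) *
      voxelAvg N (projP N fun x => stress C E Du x m n) I = 0 := by
  have hN' : ((N : ℂ) ^ 3)⁻¹ ≠ 0 := by
    have : (N : ℂ) ≠ 0 := by exact_mod_cast hN.ne'
    positivity
  refine (mul_eq_zero.1 ?_).resolve_left hN'
  have key (m n : Fin 3) := sum_conj_voxelAvg_mul_voxelAvg hN (strainCoef d m n)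
    (fourierCoef fun x => stress C E Du x m n)
  calc _ = ∑ m, ∑ n, ∑ ξ ∈ freqs N, (mollifierCoef N ξ : ℂ) ^ 2 *
      ((starRingEnd ℂ) (strainCoef d m n ξ) * fourierCoef (fun x => stress C E Du x m n) ξ) := by
        rw [Finset.sum_comm, Finset.mul_sum]
        refine Finset.sum_congr rfl fun m _ => ?_
        rw [Finset.sum_comm, Finset.mul_sum]
        refine Finset.sum_congr rfl fun n _ => ?_
        rw [← key]
        rfl
    _ = ∑ ξ ∈ freqs N, (mollifierCoef N ξ : ℂ) ^ 2 * ∑ m, ∑ n,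
      ((starRingEnd ℂ) (strainCoef d m n ξ) * fourierCoef (fun x => stress C E Du x m n) ξ) := by
        simp only [Finset.mul_sum]
        rw [Finset.sum_congr rfl fun m _ => Finset.sum_comm, Finset.sum_comm]
    _ = 0 := Finset.sum_eq_zero fun ξ _ => by
        rw [hu.sum_conj_strainCoef_mul_fourierCoef hA, mul_zero]

/-- Truncation commutes with differentiation, and the constant `E` lives in the zero mode, which is
retained. -/
lemma projP_strain {N : ℕ} (hN : 0 < N) (hu : HasH1PerGradVec u Du) (E : Mat ℝ) (m n : Fin 3)
    (x : Pt) : projP N (fun y => strain E Du y m n) x =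
      trigPoly N (strainCoef (fun k => fourierCoef fun y => (u y k : ℂ)) m n) x + toC E m n := by
  have huC := hu.clm_comp Complex.ofRealCLM
  have hf := huC.fourierCoef_symPart m n
  have hi : Integrable (fun y => symPart (fun m n => Complex.ofRealCLM (Du y m n) : Mat ℂ) m n)
    (volume.restrict cellY) := (huC.memLp_symPart m n).integrable (by norm_num)
  have hmul (ξ : Fin 3 → ℤ) : Integrable (fun y =>
      symPart (fun m n => Complex.ofRealCLM (Du y m n) : Mat ℂ) m n * expo (-ξ) y)
      (volume.restrict cellY) :=
    hi.mul_bdd (c := 1) (continuous_expo _).aestronglyMeasurable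
      (Eventually.of_forall fun x => (norm_expo _ x).le)
  have hs (y : Pt) : strain E Du y m n =
      symPart (fun m n => Complex.ofRealCLM (Du y m n) : Mat ℂ) m n + toC E m n := by
    simp [strain, toC, symPart]
  have hE : toC E m n = trigPoly N (fun ξ => if ξ = 0 then toC E m n else 0) x := by
    rw [trigPoly, Finset.sum_eq_single 0]
    · simp
    · intro ξ _ h
      simp [h]
    · exact fun h => absurd (zero_mem_freqs hN) h
  have hc (ξ : Fin 3 → ℤ) : fourierCoef (fun y => strain E Du y m n) ξ =
      strainCoef (fun k => fourierCoef fun y => (u y k : ℂ)) m n ξ +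
        if ξ = 0 then toC E m n else 0 := by
    have := congrFun hf ξ
    simp only [Complex.ofRealCLM_apply] at this
    rw [← this]
    simp only [fourierCoef, hs, add_mul]
    rw [integral_add (hmul ξ)
      ((integrableOn_of_continuous (continuous_expo _)).const_mul _), integral_const_mul,
      setIntegral_expo_cellY]
    simp
  rw [hE, trigPoly_add, projP_eq_trigPoly]
  simp only [trigPoly, hc]

/-! ### The error estimate -/

/-- Young's inequality `2a|w|s ≤ a²|w|² + s²` with `s` the sum of the three moduli: half of the left
side is absorbed, and `s²` costs the factor `3`. -/
lemma sq_mul_sum_norm_sq_le {ι : Type*} [Fintype ι] {a : ℝ} (ha : 0 ≤ a) (w z₁ z₂ z₃ : ι → ℂ)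
    (h : a * ∑ i, ‖w i‖ ^ 2 ≤ (∑ i, (starRingEnd ℂ) (w i) * (z₁ i + z₂ i - z₃ i)).re) :
    a ^ 2 * ∑ i, ‖w i‖ ^ 2 ≤ 3 * (∑ i, ‖z₁ i‖ ^ 2 + ∑ i, ‖z₂ i‖ ^ 2 + ∑ i, ‖z₃ i‖ ^ 2) := by
  have key (i : ι) : 2 * a * ((starRingEnd ℂ) (w i) * (z₁ i + z₂ i - z₃ i)).re ≤
      a ^ 2 * ‖w i‖ ^ 2 + 3 * (‖z₁ i‖ ^ 2 + ‖z₂ i‖ ^ 2 + ‖z₃ i‖ ^ 2) := by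
    have h1 : ((starRingEnd ℂ) (w i) * (z₁ i + z₂ i - z₃ i)).re ≤
        ‖w i‖ * (‖z₁ i‖ + ‖z₂ i‖ + ‖z₃ i‖) := by
      refine (Complex.re_le_norm _).trans ?_
      rw [norm_mul, RCLike.norm_conj]
      gcongr
      exact (norm_sub_le _ _).trans (by gcongr; exact norm_add_le _ _)
    have h2 := mul_le_mul_of_nonneg_left h1 (show 0 ≤ 2 * a by positivity)
    nlinarith [sq_nonneg (a * ‖w i‖ - (‖z₁ i‖ + ‖z₂ i‖ + ‖z₃ i‖)), sq_nonneg (‖z₁ i‖ - ‖z₂ i‖),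
      sq_nonneg (‖z₁ i‖ - ‖z₃ i‖), sq_nonneg (‖z₂ i‖ - ‖z₃ i‖)]
  have h1 := mul_le_mul_of_nonneg_left h (show 0 ≤ 2 * a by positivity)
  have h2 := Finset.sum_le_sum fun i (_ : i ∈ Finset.univ) => key i
  rw [← Finset.mul_sum, ← Complex.re_sum] at h2
  simp only [Finset.sum_add_distrib, ← Finset.mul_sum] at h2
  linarith

/-- Final bookkeeping of constants. The projection error carries `a`, absorbed by `a ≤ b`; since `6P
+ 2 ≥ 1`, replacing it by its square avoids a root in the constant. -/
lemma mul_le_of_sq_le {a b e s r t w P : ℝ} (hP : 0 ≤ P) (ha : 0 ≤ a) (hab : a ≤ b) (he : 0 ≤ e)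
    (hs : 0 ≤ s) (hr : 0 ≤ r) (ht : t ^ 2 ≤ 2 * w ^ 2 + 2 * e ^ 2)
    (hw : a ^ 2 * w ^ 2 ≤ 3 * P * (b ^ 2 * e ^ 2 + r ^ 2 + s ^ 2)) :
    a * t ≤ (6 * P + 2) * (b * e + s + r) := by
  have hbe : 0 ≤ b * e := mul_nonneg (ha.trans hab) he
  have h1 : a ^ 2 * e ^ 2 ≤ b ^ 2 * e ^ 2 := by gcongr
  have h2 : b ^ 2 * e ^ 2 + r ^ 2 + s ^ 2 ≤ (b * e + s + r) ^ 2 := by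
    nlinarith [mul_nonneg hbe hs, mul_nonneg hbe hr, mul_nonneg hs hr]
  have h3 : a ^ 2 * e ^ 2 ≤ (b * e + s + r) ^ 2 := by nlinarith
  have h4 := mul_le_mul_of_nonneg_left h2 (show 0 ≤ 3 * P by positivity)
  have h5 := mul_le_mul_of_nonneg_left ht (sq_nonneg a)
  have h6 : (a * t) ^ 2 ≤ (6 * P + 2) * (b * e + s + r) ^ 2 := by linarith
  have h7 : (6 * P + 2) * (b * e + s + r) ^ 2 ≤ (6 * P + 2) ^ 2 * (b * e + s + r) ^ 2 :=
    mul_le_mul_of_nonneg_right (by nlinarith) (sq_nonneg _)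
  exact le_of_sq_le_sq (by linarith) (by positivity)

lemma memLp_projP (N : ℕ) (f : Pt → ℂ) : MemLp (projP N f) 2 (volume.restrict cellY) :=
  memLp_of_continuous (contDiff_trigPoly N (fourierCoef f)).continuous

variable {N : ℕ} {Cstar : (Fin 3 → Fin N) → Tensor4} {a b : ℝ}

lemma strain_isSymm (hE : E.IsSymm) (x : Pt) : (strain E Du x).IsSymm := by
  refine Matrix.IsSymm.ext fun m n => ?_
  simp only [strain, toC, Matrix.add_apply, symPart, hE.apply m n, add_comm (Du x m n)]

/-- Strang-type estimate for the discrete energy of the error. -/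
lemma sq_mul_sum_norm_sq_strainAvg_le (hN : 0 < N) (hA : AssumptionA D Λ C)
    (hC : ∀ I, StiffnessBounds (Cstar I) a b) (hE : E.IsSymm) (hu : SolvesCellProblem C E u Du)
    {c : Fin 3 → (Fin 3 → ℤ) → ℂ}
    (hc : ∀ d, voxelForm N Cstar d (strainAvg N c + fun _ => toC E) = 0)
    {d : Fin 3 → (Fin 3 → ℤ) → ℂ} (hd : d = c - fun k => fourierCoef fun y => (u y k : ℂ)) :
    a ^ 2 * (((N : ℝ) ^ 3)⁻¹ * ∑ I, ∑ m, ∑ n, ‖strainAvg N d I m n‖ ^ 2) ≤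
      3 * (b ^ 2 * l2Norm (fun x => strain E Du x - entrywise (projP N) (strain E Du) x) ^ 2 +
        l2Norm (fun x => contract (C x - voxelField N Cstar x) (strain E Du x)) ^ 2 +
        l2Norm (fun x => stress C E Du x - entrywise (projP N) (stress C E Du) x) ^ 2) := by
  have hε := hu.1.memLp_strain E
  have hσ := hA.memLp_stress hu.1 E
  have hεi (m n : Fin 3) : IntegrableOn (fun x => strain E Du x m n) cellY :=
    (hε m n).integrable (by norm_num)
  have hσi (m n : Fin 3) : IntegrableOn (fun x => stress C E Du x m n) cellY :=
    (hσ m n).integrable (by norm_num)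
  have hPi (f : Pt → ℂ) : IntegrableOn (projP N f) cellY :=
    (memLp_projP N f).integrable (by norm_num)
  have hVi (m n : Fin 3) :
      IntegrableOn (fun x => contract (voxelField N Cstar x) (strain E Du x) m n) cellY :=
    (memLp_contract (memLp_top_voxelField N Cstar) hε m n).integrable (by norm_num)
  -- Voxel averages of the three errors: `w₁` of strain truncation, `z₂` of the stiffness, `z₃` of
  -- stress truncation.
  let w₁ : (Fin 3 → Fin N) → Mat ℂ := fun I m n =>
    voxelAvg N (fun x => (strain E Du x - entrywise (projP N) (strain E Du) x) m n) I
  let z₂ : (Fin 3 → Fin N) → Mat ℂ := fun I m n =>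
    voxelAvg N (fun x => contract (C x - voxelField N Cstar x) (strain E Du x) m n) I
  let z₃ : (Fin 3 → Fin N) → Mat ℂ := fun I m n =>
    voxelAvg N (fun x => (stress C E Du x - entrywise (projP N) (stress C E Du) x) m n) I
  let e : (Fin 3 → Fin N) → Mat ℂ := fun I m n => voxelAvg N (fun x => strain E Du x m n) I
  let pe : (Fin 3 → Fin N) → Mat ℂ := fun I m n =>
    voxelAvg N (projP N fun x => strain E Du x m n) I
  have hw₁ (I : Fin 3 → Fin N) : w₁ I = e I - pe I := by
    ext m n
    exact voxelAvg_sub (hεi m n) (hPi _) I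
  have hz₂ (I : Fin 3 → Fin N) (m n : Fin 3) :
      z₂ I m n = voxelAvg N (fun x => stress C E Du x m n) I - contract (Cstar I) (e I) m n := by
    rw [← voxelAvg_contract Cstar hεi, ← voxelAvg_sub (hσi m n) (hVi m n)]
    refine voxelAvg_congr fun x _ => ?_
    simp only [stress, contract, Pi.sub_apply, ← Finset.sum_sub_distrib, ← sub_mul]
    simp
  have hz₃ (I : Fin 3 → Fin N) (m n : Fin 3) :
      z₃ I m n = voxelAvg N (fun x => stress C E Du x m n) I -
        voxelAvg N (projP N fun x => stress C E Du x m n) I :=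
    voxelAvg_sub (hσi m n) (hPi _) I
  have hpe : strainAvg N (fun k => fourierCoef fun y => (u y k : ℂ)) + (fun _ => toC E) = pe := by
    ext I m n
    have hP : (projP N fun x => strain E Du x m n) = fun x => trigPoly N
        (strainCoef (fun k => fourierCoef fun y => (u y k : ℂ)) m n) x - -toC E m n := by
      ext x
      rw [projP_strain hN hu.1, sub_neg_eq_add]
    simp only [Pi.add_apply, Matrix.add_apply, pe, hP]
    rw [voxelAvg_sub (integrableOn_of_continuous (contDiff_trigPoly N _).continuous)
      (integrableOn_of_continuous continuous_const), voxelAvg_const hN, sub_neg_eq_add]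
    rfl
  -- The discrete equation removes `uN` and leaves `-C_N : pe`; adding the vanishing pairing with
  -- the averages of `P_N σ` turns this into the three errors.
  have hform : voxelForm N Cstar d (strainAvg N d) = ∑ I, ∑ m, ∑ n,
      (starRingEnd ℂ) (strainAvg N d I m n) *
        (contract (Cstar I) (w₁ I) m n + z₂ I m n - z₃ I m n) := by
    have h1 : strainAvg N d = (strainAvg N c + fun _ => toC E) - pe := by
      rw [hd, strainAvg_sub hN, ← hpe, add_sub_add_right_eq_sub]
    have h2 : voxelForm N Cstar d (strainAvg N d) = -voxelForm N Cstar d pe := by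
      conv_lhs => rw [h1]
      rw [voxelForm_sub, hc, zero_sub]
    have h3 := hu.sum_conj_strainAvg_mul_voxelAvg_projP hN hA d
    rw [h2, ← add_zero (-voxelForm N Cstar d pe), ← h3, voxelForm]
    simp only [← Finset.sum_neg_distrib, ← Finset.sum_add_distrib]
    refine Finset.sum_congr rfl fun I _ => Finset.sum_congr rfl fun m _ =>
      Finset.sum_congr rfl fun n _ => ?_
    rw [hw₁, contract_sub, Matrix.sub_apply, hz₂, hz₃]
    ring
  -- The bound by `b` holds on symmetric matrices only; symmetry of `E` enters here.
  have hw₁s (I : Fin 3 → Fin N) : (w₁ I).IsSymm := by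
    have hs (m n : Fin 3) : (fun x => strain E Du x n m) = fun x => strain E Du x m n :=
      funext fun x => (strain_isSymm hE x).apply m n
    refine Matrix.IsSymm.ext fun m n => voxelAvg_congr fun x _ => ?_
    simp only [Matrix.sub_apply, entrywise, hs m n, (strain_isSymm hE x).apply m n]
  have hq := le_re_voxelForm hC d
  rw [hform] at hq
  have hmain := sq_mul_sum_norm_sq_le (ι := (Fin 3 → Fin N) × Fin 3 × Fin 3)
    (hC fun _ => ⟨0, hN⟩).lower_pos.le
    (fun i => strainAvg N d i.1 i.2.1 i.2.2) (fun i => contract (Cstar i.1) (w₁ i.1) i.2.1 i.2.2)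
    (fun i => z₂ i.1 i.2.1 i.2.2) (fun i => z₃ i.1 i.2.1 i.2.2)
    (by simpa only [Fintype.sum_prod_type] using hq)
  simp only [Fintype.sum_prod_type] at hmain
  have hN3 : (0 : ℝ) ≤ ((N : ℝ) ^ 3)⁻¹ := by positivity
  have hb₁ : ((N : ℝ) ^ 3)⁻¹ * ∑ I, ∑ m, ∑ n, ‖contract (Cstar I) (w₁ I) m n‖ ^ 2 ≤
      b ^ 2 * l2Norm (fun x => strain E Du x - entrywise (projP N) (strain E Du) x) ^ 2 := by
    calc ((N : ℝ) ^ 3)⁻¹ * ∑ I, ∑ m, ∑ n, ‖contract (Cstar I) (w₁ I) m n‖ ^ 2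
        ≤ ((N : ℝ) ^ 3)⁻¹ * ∑ I, b ^ 2 * ∑ m, ∑ n, ‖w₁ I m n‖ ^ 2 := by
          gcongr with I
          exact (hC I).upper_complex (hw₁s I)
      _ = b ^ 2 * (((N : ℝ) ^ 3)⁻¹ * ∑ I, ∑ m, ∑ n, ‖w₁ I m n‖ ^ 2) := by
          rw [← Finset.mul_sum]; ring
      _ ≤ _ := by
          gcongr
          exact sum_norm_sq_voxelAvg_le_l2Norm fun m n => (hε m n).sub (memLp_projP N _)
  have hb₂ : ((N : ℝ) ^ 3)⁻¹ * ∑ I, ∑ m, ∑ n, ‖z₂ I m n‖ ^ 2 ≤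
      l2Norm (fun x => contract (C x - voxelField N Cstar x) (strain E Du x)) ^ 2 :=
    sum_norm_sq_voxelAvg_le_l2Norm fun m n => memLp_contract
      (fun m n p q => (hA.memLp_top m n p q).sub (memLp_top_voxelField N Cstar m n p q)) hε m n
  have hb₃ : ((N : ℝ) ^ 3)⁻¹ * ∑ I, ∑ m, ∑ n, ‖z₃ I m n‖ ^ 2 ≤
      l2Norm (fun x => stress C E Du x - entrywise (projP N) (stress C E Du) x) ^ 2 :=
    sum_norm_sq_voxelAvg_le_l2Norm fun m n => (hσ m n).sub (memLp_projP N _)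
  have := mul_le_mul_of_nonneg_left hmain hN3
  linarith

lemma mul_l2Norm_sub_le (hN : 0 < N) (hA : AssumptionA D Λ C)
    (hC : ∀ I, StiffnessBounds (Cstar I) a b) (hE : E.IsSymm) (hu : SolvesCellProblem C E u Du)
    {uN : Pt → Fin 3 → ℂ} (huN : SolvesMS N Cstar E uN) :
    a * l2Norm (fun x => symPart (gradVec uN x) - toC (symPart (Du x))) ≤
      (6 * (Real.pi / 2) ^ 6 + 2) *
        (b * l2Norm (fun x => strain E Du x - entrywise (projP N) (strain E Du) x) +
          l2Norm (fun x => stress C E Du x - entrywise (projP N) (stress C E Du) x) +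
          l2Norm (fun x => contract (C x - voxelField N Cstar x) (strain E Du x))) := by
  obtain ⟨c, rfl⟩ := huN.exists_trigPoly
  have hc := ((solvesMS_trigPoly_iff hN Cstar E c).1 huN).2
  set d : Fin 3 → (Fin 3 → ℤ) → ℂ := c - fun k => fourierCoef fun y => (u y k : ℂ) with hd
  have hmain := sq_mul_sum_norm_sq_strainAvg_le hN hA hC hE hu hc hd
  set e := l2Norm (fun x => strain E Du x - entrywise (projP N) (strain E Du) x) with he
  set s := l2Norm (fun x => stress C E Du x - entrywise (projP N) (stress C E Du) x) with hs
  set r := l2Norm (fun x => contract (C x - voxelField N Cstar x) (strain E Du x)) with hr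
  have he0 : 0 ≤ e := l2Norm_nonneg _
  have hs0 : 0 ≤ s := l2Norm_nonneg _
  have hr0 : 0 ≤ r := l2Norm_nonneg _
  have hab := (hC fun _ => ⟨0, hN⟩).le_upper
  have ha := (hC fun _ => ⟨0, hN⟩).lower_pos
  have hb := (hC fun _ => ⟨0, hN⟩).upper_pos
  have hpi := Real.pi_pos
  let W : Pt → Mat ℂ := fun x m n => trigPoly N (strainCoef d m n) x
  have hWm (m n : Fin 3) : MemLp (fun x => W x m n) 2 (volume.restrict cellY) :=
    memLp_of_continuous (contDiff_trigPoly N _).continuous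
  have hW : (2 / Real.pi) ^ 6 * l2Norm W ^ 2 ≤
      ((N : ℝ) ^ 3)⁻¹ * ∑ I, ∑ m, ∑ n, ‖strainAvg N d I m n‖ ^ 2 := by
    rw [l2Norm_sq_eq_sum hWm]
    simp only [W, setIntegral_norm_sq_trigPoly]
    exact sum_norm_sq_strainCoef_le hN d
  -- Insert `P_N u`: a discrete part `W`, controlled by stability, and the truncation error of the
  -- strain, where `E` cancels.
  have hsplit : (fun x => symPart (gradVec (fun x n => trigPoly N (c n) x) x) -
      toC (symPart (Du x))) =
      fun x => W x - (strain E Du x - entrywise (projP N) (strain E Du) x) := by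
    ext x m n
    have hdc : strainCoef d m n = fun ξ => strainCoef c m n ξ -
        strainCoef (fun k => fourierCoef fun y => (u y k : ℂ)) m n ξ :=
      funext (strainCoef_sub c _ m n)
    have hst : strain E Du x m n = toC (symPart (Du x)) m n + toC E m n := by
      simp [strain, toC]
    change symPart (gradVec _ x) m n - toC (symPart (Du x)) m n =
      trigPoly N (strainCoef d m n) x -
        (strain E Du x m n - projP N (fun y => strain E Du y m n) x)
    rw [symPart_gradVec_trigPoly, projP_strain hN hu.1, hdc, ← trigPoly_sub, hst]
    ring
  have htri : l2Norm (fun x => symPart (gradVec (fun x n => trigPoly N (c n) x) x) -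
      toC (symPart (Du x))) ^ 2 ≤ 2 * l2Norm W ^ 2 + 2 * e ^ 2 := by
    rw [hsplit]
    exact l2Norm_sub_sq_le hWm fun m n => (hu.1.memLp_strain E m n).sub (memLp_projP N _)
  have h1 : a ^ 2 * l2Norm W ^ 2 ≤
      3 * (Real.pi / 2) ^ 6 * (b ^ 2 * e ^ 2 + r ^ 2 + s ^ 2) := by
    -- `(π/2)^6` is the inverse of the stability constant of `sum_norm_sq_strainCoef_le`.
    have hinv : (Real.pi / 2) ^ 6 * (2 / Real.pi) ^ 6 = 1 := by
      rw [← mul_pow]; field_simp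
    calc a ^ 2 * l2Norm W ^ 2
        = (Real.pi / 2) ^ 6 * (a ^ 2 * ((2 / Real.pi) ^ 6 * l2Norm W ^ 2)) := by
          linear_combination -(a ^ 2 * l2Norm W ^ 2) * hinv
      _ ≤ (Real.pi / 2) ^ 6 * (a ^ 2 *
          (((N : ℝ) ^ 3)⁻¹ * ∑ I, ∑ m, ∑ n, ‖strainAvg N d I m n‖ ^ 2)) := by gcongr
      _ ≤ (Real.pi / 2) ^ 6 * (3 * (b ^ 2 * e ^ 2 + r ^ 2 + s ^ 2)) := by gcongr
      _ = _ := by ring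
  exact mul_le_of_sq_le (by positivity) ha.le hab he0 hs0 hr0 htri h1

end CellProblem

/-! ### The main theorem -/

theorem mainTheorem1 :
    ∃ K : ℝ, 0 < K ∧
      ∀ (M : ℕ) (D : Fin (M + 1) → Set Pt) (Λ : Fin (M + 1) → Tensor4) (Λ' Λ'' : ℝ)
        (C : Pt → Tensor4) (N : ℕ) (Cstar : (Fin 3 → Fin N) → Tensor4) (E : Mat ℝ),
        0 < N → AssumptionA D Λ C → AssumptionB Λ Λ' Λ'' → AssumptionC N D Λ Cstar → E.IsSymm →
        (∃! uN : Pt → Fin 3 → ℂ, SolvesMS N Cstar E uN) ∧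
        ∀ (u : Pt → Fin 3 → ℝ) (Du : Pt → Mat ℝ) (uN : Pt → Fin 3 → ℂ),
          SolvesCellProblem C E u Du → SolvesMS N Cstar E uN →
          Λ' * l2Norm (fun x => symPart (gradVec uN x) - toC (symPart (Du x))) ≤
            K * (Λ'' * l2Norm (fun x => strain E Du x - entrywise (projP N) (strain E Du) x) +
              l2Norm (fun x => stress C E Du x - entrywise (projP N) (stress C E Du) x) +
              l2Norm (fun x => contract (C x - voxelField N Cstar x) (strain E Du x))) := by
  refine ⟨6 * (Real.pi / 2) ^ 6 + 2, by positivity, ?_⟩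
  intro M D Λ Λ' Λ'' C N Cstar E hN hA hB hC hE
  have hCs := stiffnessBounds_voxel hB hC
  exact ⟨existsUnique_solvesMS hN hCs E, fun u Du uN hu huN =>
    mul_l2Norm_sub_le hN hA hCs hE hu huN⟩
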